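/- **Setting.** Let $d\in\{2,3\}$ and let $\mathcal T$ be a conforming affine simplicial triangulation of a connected polygonal/polyhedral domain $\Omega\subset\mathbb R^d$, with set of facets $\mathcal F$. On $\partial T$ let $N$ be the outer unit normal of $T\in\mathcal T$, $v_t=v-(N\cdot v)N$ and $P_{tn}=(I-N\otimes N)PN$. Let $\Gamma_{D,n},\Gamma_{D,t}$ be unions of boundary facets such that the only constant vector $c$ with $c\cdot N=0$ on $\Gamma_{D,n}$ and $c_t=0$ on $\Gamma_{D,t}$ is $c=0$. For $k\ge 0$ let - $V_h$ be the space of $u$ with $u|_T\in\mathcal P^k(T,\mathbb R^d)+\tilde{\mathcal P}^k(T)X$ for all $T$ ($\tilde{\mathcal P}^k$: homogeneous polynomials of degree $k$), $u\cdot N$ continuous across interior facets, and $u\cdot N=0$ on $\Gamma_{D,n}$; - $\Lambda_h$ be the space of $\tilde u\in\mathcal P^k(\mathcal F,\mathbb R^d)$ with $\tilde u\cdot N=0$ on all facets and $\tilde u=0$ on $\Gamma_{D,t}$; - $\Sigma_h=\mathcal P^k(\mathcal T,\mathbb R^{d\times d})$ (discontinuous), $F_h=\Sigma_h^{\mathsf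 T}$, and $Q_h=\mathcal P^k(\mathcal T)$. Let $\mu>0$, $\varepsilon_p>0$, $\varepsilon_\lambda>0$, let $\tau\ge 0$ be constant on each facet of each element, and let $C\in C^2((0,\infty))$ satisfy $C(J)=0\iff J=1$ (e.g. $C(J)=J-1$ or $C(J)=\ln J$). Let $(u^n,\tilde u^n,F^n,P^n,p^n)$ be a state in the above spaces without the conditions on $\Gamma_{D,n},\Gamma_{D,t}$ (for instance the $n$-th iterate of the quasi-Newton–Raphson method) with $J^n=\det F^n>0$ on every closed element. For $A\in\mathbb R^{d\times d}$ put $$\mathbb A A=\mu A-p^n\big(C''(J^n)(\operatorname{cof}F^n:A)\operatorname{cof}F^n+C'(J^n)\,\partial_F\operatorname{cof}(F^n)[A]\big),$$ $$\tilde{\mathbb A}=\mathbb A+\max\{\varepsilon_\lambda,\ \varepsilon_\lambda-\min\lambda_{\mathbb A}\}\,\mathbb I,$$ where $\min\lambda_{\mathbb A}$ is the (pointwise) smallest eigenvalue of $\mathbb A$, and $$b(p,G)=-p\,C'(J^n)\operatorname{cof}F^n:G,\qquad \langle\mathrm{Grad}\,u,P\rangle=\sum_{T\in\mathcal T}\Big(\int_T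 P:\mathrm{Grad}\,u\,dV-\int_{\partial T}P_{tn}\cdot u_t\,dA\Big).$$ **Theorem.** The space $V_h\times\Lambda_h\times F_h\times\Sigma_h\times Q_h$ is finite-dimensional, and with respect to every basis of it the stiffness matrix of the linearized, hybridized and stabilized system with left-hand sides $$\begin{aligned} \delta F:&\quad \int_\Omega (\tilde{\mathbb A}\,\Delta F):\delta F+b(\Delta p,\delta F)-\Delta P:\delta F\,dV,\\ \delta p:&\quad \int_\Omega b(\delta p,\Delta F)-\varepsilon_p\,\Delta p\,\delta p\,dV,\\ \delta P:&\quad -\int_\Omega\Delta F:\delta P\,dV+\langle\mathrm{Grad}\,\Delta u,\delta P\rangle+\sum_{T\in\mathcal T}\int_{\partial T}\Delta\tilde u_t\cdot\delta P_{tn}\,dA,\\ (\delta u,\delta\tilde u):&\quad \langle\mathrm{Grad}\,\delta u,\Delta P\rangle+\sum_{T\in\mathcal T}\int_{\partial T}\delta\tilde u_t\cdot\Delta P_{tn}+\tau(\Delta u-\Delta\tilde u)_t\cdot(\delta u-\delta\tilde u)_t\,dA \end{aligned}$$ (increments and test functions both from this space) is invertible. -/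

import Mathlib

open scoped MeasureTheory Matrix

noncomputable section

namespace NDTNS

/-- The Euclidean space `ℝ^d`. -/
abbrev E (d : ℕ) := EuclideanSpace ℝ (Fin d)

/-- Second-order tensors `ℝ^{d×d}`. -/
abbrev Mat (d : ℕ) := Matrix (Fin d) (Fin d) ℝ

/-- Real polynomials in the coordinates `X_1, …, X_d`. -/
abbrev Poly (d : ℕ) := MvPolynomial (Fin d) ℝ

/-! ### Tensor algebra and the material tensor -/

/-- The Frobenius product `A : B`. -/
def frob {d : ℕ} (A B : Mat d) : ℝ := ∑ i, ∑ j, A i j * B i j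

/-- The cofactor matrix. -/
def cof {d : ℕ} (F : Mat d) : Mat d := F.adjugateᵀ

/-- The derivative `∂_F cof(F)[A]` of the cofactor matrix at `F` in direction `A`
(in three dimensions, the tensor cross product of `F` and `A`). -/
def cofDeriv {d : ℕ} (F A : Mat d) : Mat d :=
  Matrix.of fun i j => deriv (fun t : ℝ => cof (F + t • A) i j) 0

/-- A volumetric response function `C : ℝ⁺ → ℝ`: twice continuously differentiable on `(0,∞)`,
with `C(J) = 0` if and only if `J = 1`. -/
structure IsVolumetricResponse (C : ℝ → ℝ) : Prop where
  smooth : ContDiffOn ℝ 2 C (Set.Ioi 0)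
  zero_iff : ∀ J : ℝ, 0 < J → (C J = 0 ↔ J = 1)

/-- The tensor `𝔸(F,p) = ∂²W/∂F² - p ∂(C'(J) cof F)/∂F` of the neo-Hookean energy
`W(F) = μ/2 (F : F - d)`, applied to `A`; here `J = det F`. -/
def materialTensor {d : ℕ} (μ : ℝ) (C : ℝ → ℝ) (F : Mat d) (p : ℝ) (A : Mat d) : Mat d :=
  μ • A - p • ((deriv (deriv C) F.det * frob (cof F) A) • cof F + deriv C F.det • cofDeriv F A)

/-- The smallest eigenvalue of a (symmetric) fourth-order tensor. -/
def minEigenvalue {d : ℕ} (𝔸 : Mat d → Mat d) : ℝ :=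
  sInf {l : ℝ | ∃ A : Mat d, A ≠ 0 ∧ 𝔸 A = l • A}

/-- The shift `max {ε, ε - min λ_𝔸} = ε + max {0, - min λ_𝔸}`. -/
def eigenvalueShift {d : ℕ} (ε : ℝ) (𝔸 : Mat d → Mat d) : ℝ :=
  max ε (ε - minEigenvalue 𝔸)

/-- The shifted tensor: `𝔸` plus the shift times the fourth-order identity. -/
def shiftedTensor {d : ℕ} (ε : ℝ) (𝔸 : Mat d → Mat d) (A : Mat d) : Mat d :=
  𝔸 A + eigenvalueShift ε 𝔸 • A

/-- `b(F; p, G) = - p C'(J) cof F : G` with `J = det F`. -/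
def bForm {d : ℕ} (C : ℝ → ℝ) (F : Mat d) (p : ℝ) (G : Mat d) : ℝ :=
  -(p * deriv C F.det * frob (cof F) G)

/-! ### Triangulations -/

/-- A conforming simplicial triangulation of a polygonal or polyhedral domain in `ℝ^d`: a finite
geometric simplicial complex in which every simplex is a face of a `d`-simplex.  That the domain
(the interior of the union of the simplices) is connected is expressed through the mesh: any two
elements are joined by a chain of elements, consecutive ones sharing a facet. -/
structure Mesh (d : ℕ) where
  complex : Geometry.SimplicialComplex ℝ (E d)
  finite : complex.faces.Finite
  nonempty : complex.faces.Nonempty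
  pure : ∀ s ∈ complex.faces, ∃ T ∈ complex.faces, T.card = d + 1 ∧ s ⊆ T
  connected : ∀ T ∈ complex.faces, ∀ T' ∈ complex.faces, T.card = d + 1 → T'.card = d + 1 →
    Relation.ReflTransGen
      (fun A B : Finset (E d) => B ∈ complex.faces ∧ B.card = d + 1 ∧
        ∃ F : Finset (E d), F.card = d ∧ F ⊆ A ∧ F ⊆ B) T T'

variable {d : ℕ} (M : Mesh d)

/-- The elements `T ∈ 𝒯`, given by their `d + 1` vertices. -/
def Mesh.Elem : Type := {T : Finset (E d) // T ∈ M.complex.faces ∧ T.card = d + 1}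

/-- The facets of the skeleton `ℱ`, given by their `d` vertices. -/
def Mesh.Facet : Type := {F : Finset (E d) // F ∈ M.complex.faces ∧ F.card = d}

instance : Finite M.Elem :=
  (M.finite.subset (t := {T | T ∈ M.complex.faces ∧ T.card = d + 1}) fun _ h => h.1).to_subtype

instance : Finite M.Facet :=
  (M.finite.subset (t := {F | F ∈ M.complex.faces ∧ F.card = d}) fun _ h => h.1).to_subtype

instance : Fintype M.Elem := Fintype.ofFinite _

instance : Fintype M.Facet := Fintype.ofFinite _

variable {M}

/-- The closed simplex spanned by the vertices of an element. -/
def Mesh.Elem.carrier (T : M.Elem) : Set (E d) := convexHull ℝ (T.1 : Set (E d))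

/-- The closed simplex spanned by the vertices of a facet. -/
def Mesh.Facet.carrier (F : M.Facet) : Set (E d) := convexHull ℝ (F.1 : Set (E d))

/-- `F` is a facet of the element `T`. -/
def Mesh.Facet.IsFacetOf (F : M.Facet) (T : M.Elem) : Prop := F.1 ⊆ T.1

open Classical in
/-- The facets that make up the boundary of an element. -/
def Mesh.Elem.facets (T : M.Elem) : Finset M.Facet :=
  Finset.univ.filter fun F => F.IsFacetOf T

/-- A boundary facet belongs to exactly one element. -/
def Mesh.Facet.IsBoundary (F : M.Facet) : Prop := ∃! T : M.Elem, F.IsFacetOf T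

open Classical in
/-- The outer unit normal of the element `T` on its facet `F`: the vectors from the vertex of `T`
opposite to `F` to the vertices of `F` are summed up, projected orthogonally to `F`, and
normalized. -/
def outerNormal (T : M.Elem) (F : M.Facet) : E d :=
  let w : E d := ∑ x ∈ F.1, ∑ v ∈ T.1 \ F.1, (x - v)
  let n : E d := (vectorSpan ℝ (F.1 : Set (E d)))ᗮ.starProjection w
  ‖n‖⁻¹ • n

/-- Tangential part `v_t = v - (N · v) N` with respect to the unit vector `N`. -/
def tang (N v : E d) : E d := v - inner ℝ N v • N

/-- Tangential-normal component `P_tn = (I - N ⊗ N) P N`. -/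
def tanNormal (N : E d) (P : Mat d) : E d := tang N (WithLp.toLp 2 (P *ᵥ fun i => N i))

/-! ### Piecewise polynomials

A polynomial function on an element is determined by, and identified with, its polynomial. -/

/-- Value of a scalar polynomial. -/
def ev (q : Poly d) (x : E d) : ℝ := MvPolynomial.eval (fun i => x i) q

/-- Value of a vector of polynomials. -/
def evV (u : Fin d → Poly d) (x : E d) : E d := WithLp.toLp 2 fun i => ev (u i) x

/-- Value of a matrix of polynomials. -/
def evM (A : Matrix (Fin d) (Fin d) (Poly d)) (x : E d) : Mat d := Matrix.of fun i j => ev (A i j) x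

/-- `(Grad u)_{ij} = ∂u_i / ∂X_j`. -/
def grad (u : Fin d → Poly d) : Matrix (Fin d) (Fin d) (Poly d) :=
  Matrix.of fun i j => MvPolynomial.pderiv j (u i)

/-- The linear map `q ↦ q X`. -/
def mulX (d : ℕ) : Poly d →ₗ[ℝ] (Fin d → Poly d) :=
  LinearMap.pi fun i => LinearMap.mulRight ℝ (MvPolynomial.X i)

/-- The local Raviart–Thomas space: vector polynomials of degree at most `k`, plus homogeneous
polynomials of degree `k` times `X`. -/
def localRT (d k : ℕ) : Submodule ℝ (Fin d → Poly d) :=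
  Submodule.pi Set.univ (fun _ => MvPolynomial.restrictTotalDegree (Fin d) ℝ k) ⊔
    (MvPolynomial.homogeneousSubmodule (Fin d) ℝ k).map (mulX d)

lemma evV_add (u v : Fin d → Poly d) (x : E d) : evV (u + v) x = evV u x + evV v x := by
  ext i; simp [evV, ev]

lemma evV_smul (c : ℝ) (u : Fin d → Poly d) (x : E d) : evV (c • u) x = c • evV u x := by
  ext i; simp [evV, ev, MvPolynomial.smul_eval]

lemma evV_zero (x : E d) : evV (0 : Fin d → Poly d) x = 0 := by
  ext i; simp [evV, ev]

variable (M)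

/-- The Raviart–Thomas space of order `k` with vanishing normal component on the facets in `ΓDn`:
locally Raviart–Thomas, with normal component continuous across interior facets. -/
def displacementSpace (k : ℕ) (ΓDn : Set M.Facet) : Submodule ℝ (M.Elem → Fin d → Poly d) where
  carrier := {u | (∀ T, u T ∈ localRT d k) ∧
    (∀ (F : M.Facet) (T T' : M.Elem), F.IsFacetOf T → F.IsFacetOf T' → ∀ x ∈ F.carrier,
      inner ℝ (evV (u T) x - evV (u T') x) (outerNormal T F) = 0) ∧
    (∀ F ∈ ΓDn, ∀ T : M.Elem, F.IsFacetOf T → ∀ x ∈ F.carrier,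
      inner ℝ (evV (u T) x) (outerNormal T F) = 0)}
  add_mem' := by
    rintro u v ⟨hu₁, hu₂, hu₃⟩ ⟨hv₁, hv₂, hv₃⟩
    refine ⟨fun T => Submodule.add_mem _ (hu₁ T) (hv₁ T), fun F T T' h h' x hx => ?_,
      fun F hF T h x hx => ?_⟩
    · have a := hu₂ F T T' h h' x hx
      have b := hv₂ F T T' h h' x hx
      simp only [inner_sub_left] at a b
      simp only [Pi.add_apply, evV_add, inner_sub_left, inner_add_left]
      linarith
    · simp only [Pi.add_apply, evV_add, inner_add_left, hu₃ F hF T h x hx, hv₃ F hF T h x hx,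
        add_zero]
  zero_mem' := ⟨fun _ => Submodule.zero_mem _, by simp [evV_zero], by simp [evV_zero]⟩
  smul_mem' := by
    rintro c u ⟨hu₁, hu₂, hu₃⟩
    refine ⟨fun T => Submodule.smul_mem _ c (hu₁ T), fun F T T' h h' x hx => ?_,
      fun F hF T h x hx => ?_⟩
    · simp only [Pi.smul_apply, evV_smul, ← smul_sub, inner_smul_left, hu₂ F T T' h h' x hx,
        mul_zero]
    · simp only [Pi.smul_apply, evV_smul, inner_smul_left, hu₃ F hF T h x hx, mul_zero]

/-- The hybridization space: on every facet a vector field that is polynomial of degree at most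
`k` and tangential, vanishing on the facets in `ΓDt`.  A function on a facet is represented by
its extension by zero. -/
def facetSpace (k : ℕ) (ΓDt : Set M.Facet) : Submodule ℝ (M.Facet → E d → E d) where
  carrier := {v | (∀ F : M.Facet, ∃ q : Fin d → Poly d,
      (∀ i, q i ∈ MvPolynomial.restrictTotalDegree (Fin d) ℝ k) ∧
      (∀ x ∈ F.carrier, v F x = evV q x) ∧ ∀ x ∉ F.carrier, v F x = 0) ∧
    (∀ (F : M.Facet) (T : M.Elem), F.IsFacetOf T → ∀ x ∈ F.carrier,
      inner ℝ (v F x) (outerNormal T F) = 0) ∧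
    (∀ F ∈ ΓDt, ∀ x ∈ F.carrier, v F x = 0)}
  add_mem' := by
    rintro u v ⟨hu₁, hu₂, hu₃⟩ ⟨hv₁, hv₂, hv₃⟩
    refine ⟨fun F => ?_, fun F T h x hx => ?_, fun F hF x hx => ?_⟩
    · obtain ⟨q, hq₁, hq₂, hq₃⟩ := hu₁ F
      obtain ⟨r, hr₁, hr₂, hr₃⟩ := hv₁ F
      refine ⟨q + r, fun i => Submodule.add_mem _ (hq₁ i) (hr₁ i), fun x hx => ?_, fun x hx => ?_⟩
      · simp only [Pi.add_apply, evV_add, hq₂ x hx, hr₂ x hx]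
      · simp only [Pi.add_apply, hq₃ x hx, hr₃ x hx, add_zero]
    · simp only [Pi.add_apply, inner_add_left, hu₂ F T h x hx, hv₂ F T h x hx, add_zero]
    · simp only [Pi.add_apply, hu₃ F hF x hx, hv₃ F hF x hx, add_zero]
  zero_mem' := ⟨fun _ => ⟨0, fun _ => Submodule.zero_mem _, by simp [evV_zero], by simp⟩,
    by simp, by simp⟩
  smul_mem' := by
    rintro c u ⟨hu₁, hu₂, hu₃⟩
    refine ⟨fun F => ?_, fun F T h x hx => ?_, fun F hF x hx => ?_⟩
    · obtain ⟨q, hq₁, hq₂, hq₃⟩ := hu₁ F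
      refine ⟨c • q, fun i => Submodule.smul_mem _ c (hq₁ i), fun x hx => ?_, fun x hx => ?_⟩
      · simp only [Pi.smul_apply, evV_smul, hq₂ x hx]
      · simp only [Pi.smul_apply, hq₃ x hx, smul_zero]
    · simp only [Pi.smul_apply, inner_smul_left, hu₂ F T h x hx, mul_zero]
    · simp only [Pi.smul_apply, hu₃ F hF x hx, smul_zero]

/-- The discontinuous stress space: all piecewise polynomial matrix fields of degree at
most `k`. -/
def stressSpace (k : ℕ) : Submodule ℝ (M.Elem → Matrix (Fin d) (Fin d) (Poly d)) where
  carrier := {P | ∀ T i j, P T i j ∈ MvPolynomial.restrictTotalDegree (Fin d) ℝ k}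
  add_mem' hP hR T i j := Submodule.add_mem _ (hP T i j) (hR T i j)
  zero_mem' _ _ _ := Submodule.zero_mem _
  smul_mem' c _ hP T i j := Submodule.smul_mem _ c (hP T i j)

/-- The space of deformation gradients: the transposes of the members of the discontinuous stress
space. -/
def defGradSpace (k : ℕ) : Submodule ℝ (M.Elem → Matrix (Fin d) (Fin d) (Poly d)) where
  carrier := {F | (fun T => (F T)ᵀ) ∈ stressSpace M k}
  add_mem' hF hG T i j := Submodule.add_mem _ (hF T i j) (hG T i j)
  zero_mem' _ _ _ := Submodule.zero_mem _
  smul_mem' c _ hF T i j := Submodule.smul_mem _ c (hF T i j)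

/-- The pressure space: all piecewise polynomials of degree at most `k`. -/
def pressureSpace (k : ℕ) : Submodule ℝ (M.Elem → Poly d) :=
  Submodule.pi Set.univ fun _ => MvPolynomial.restrictTotalDegree (Fin d) ℝ k

/-- The finite element space of the hybridized five-field system in `(u, ũ, F, P, p)`, with
homogeneous essential conditions `u_n = 0` on `ΓDn` and `ũ_t = 0` on `ΓDt`. -/
abbrev Fields (k : ℕ) (ΓDn ΓDt : Set M.Facet) : Type :=
  displacementSpace M k ΓDn × facetSpace M k ΓDt × defGradSpace M k × stressSpace M k ×
    pressureSpace M k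

variable {M} {k : ℕ} {ΓDn ΓDt : Set M.Facet}

/-- The displacement `u`, element by element. -/
def Fields.u (w : Fields M k ΓDn ΓDt) : M.Elem → Fin d → Poly d := w.1.1

/-- The hybridization field `ũ`, facet by facet. -/
def Fields.uHyb (w : Fields M k ΓDn ΓDt) : M.Facet → E d → E d := w.2.1.1

/-- The deformation gradient `F`. -/
def Fields.F (w : Fields M k ΓDn ΓDt) : M.Elem → Matrix (Fin d) (Fin d) (Poly d) := w.2.2.1.1

/-- The first Piola–Kirchhoff stress `P`. -/
def Fields.P (w : Fields M k ΓDn ΓDt) : M.Elem → Matrix (Fin d) (Fin d) (Poly d) := w.2.2.2.1.1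

/-- The pressure `p`. -/
def Fields.p (w : Fields M k ΓDn ΓDt) : M.Elem → Poly d := w.2.2.2.2.1

/-! ### The linearized, hybridized and stabilized system -/

/-- `∑_T ∫_{∂T} g dA`, the integrand `g` depending on element, facet and point. -/
def boundaryIntegral (g : M.Elem → M.Facet → E d → ℝ) : ℝ :=
  ∑ T : M.Elem, ∑ F ∈ T.facets, ∫ x in F.carrier, g T F x ∂μHE[d - 1]

/-- `∫_Ω g dV`, the integrand being given element by element. -/
def domainIntegral (g : M.Elem → E d → ℝ) : ℝ :=
  ∑ T : M.Elem, ∫ x in T.carrier, g T x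

/-- The pairing `⟨Grad u, P⟩_𝒯 = ∑_T (∫_T P : Grad u dV - ∫_{∂T} P_tn · u_t dA)`. -/
def gradPairing (u : M.Elem → Fin d → Poly d)
    (P : M.Elem → Matrix (Fin d) (Fin d) (Poly d)) : ℝ :=
  domainIntegral (fun T x => frob (evM (P T) x) (evM (grad (u T)) x)) -
    boundaryIntegral (fun T F x => inner ℝ (tanNormal (outerNormal T F) (evM (P T) x))
      (tang (outerNormal T F) (evV (u T) x)))

/-- The hybridization term `∑_T ∫_{∂T} P_tn · ũ_t dA`. -/
def hybPairing (v : M.Facet → E d → E d)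
    (P : M.Elem → Matrix (Fin d) (Fin d) (Poly d)) : ℝ :=
  boundaryIntegral fun T F x => inner ℝ (tanNormal (outerNormal T F) (evM (P T) x))
    (tang (outerNormal T F) (v F x))

/-- The parameters: shear modulus `μ`, volumetric response `C`, eigenvalue shift parameter
`ε_λ`, pressure regularization `ε_p`, and the HDG parameter `τ`, which may differ between
elements and facets. -/
structure Params (M : Mesh d) where
  μ : ℝ
  C : ℝ → ℝ
  εlam : ℝ
  εp : ℝ
  τ : M.Elem → M.Facet → ℝ

variable (π : Params M) (s : Fields M k ∅ ∅) (w δ : Fields M k ΓDn ΓDt)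

/-- Left-hand side of the equation tested by `δF`, at the iterate `s`, with the shifted tensor:
`∫ (Ã(Fⁿ,pⁿ) ΔF) : δF + b(Fⁿ; Δp, δF) - ΔP : δF dV`. -/
def equationF : ℝ :=
  domainIntegral fun T x =>
    frob (shiftedTensor π.εlam (materialTensor π.μ π.C (evM (s.F T) x) (ev (s.p T) x))
        (evM (w.F T) x)) (evM (δ.F T) x) +
      bForm π.C (evM (s.F T) x) (ev (w.p T) x) (evM (δ.F T) x) -
      frob (evM (w.P T) x) (evM (δ.F T) x)

/-- Left-hand side of the equation tested by `δp`, with the pressure regularization: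
`∫ b(Fⁿ; δp, ΔF) - ε_p Δp δp dV`. -/
def equationp : ℝ :=
  domainIntegral fun T x =>
    bForm π.C (evM (s.F T) x) (ev (δ.p T) x) (evM (w.F T) x) -
      π.εp * ev (w.p T) x * ev (δ.p T) x

/-- Left-hand side of the equation tested by `δP`:
`- ∫ ΔF : δP dV + ⟨Grad Δu, δP⟩ + ∑_T ∫_{∂T} Δũ_t · δP_tn dA`. -/
def equationP : ℝ :=
  -domainIntegral (fun T x => frob (evM (w.F T) x) (evM (δ.P T) x)) +
    gradPairing w.u δ.P + hybPairing w.uHyb δ.P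

/-- Left-hand side of the equation tested by `(δu, δũ)`, with the HDG stabilization:
`⟨Grad δu, ΔP⟩ + ∑_T ∫_{∂T} (δũ_t · ΔP_tn + τ (Δu - Δũ)_t · (δu - δũ)_t) dA`. -/
def equationU : ℝ :=
  gradPairing δ.u w.P + hybPairing δ.uHyb w.P +
    boundaryIntegral fun T F x => π.τ T F *
      inner ℝ (tang (outerNormal T F) (evV (w.u T) x - w.uHyb F x))
        (tang (outerNormal T F) (evV (δ.u T) x - δ.uHyb F x))

/-- The form of the linearized system at the iterate `s`: all four equations, with increment `w`
and test function `δ`. -/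
def stiffnessForm : ℝ :=
  equationF π s w δ + equationp π s w δ + equationP w δ + equationU π w δ

/-- The stiffness matrix with respect to a basis of the finite element space. -/
def stiffnessMatrix {ι : Type} (b : Module.Basis ι ℝ (Fields M k ΓDn ΓDt)) : Matrix ι ι ℝ :=
  Matrix.of fun i j => stiffnessForm π s (b j) (b i)

end NDTNS

end

/-! The matrix is square, so it suffices that an increment `w` annihilated by all test functions
vanishes.

Testing with `(Δu, Δũ, ΔF, -ΔP, -Δp)` cancels every coupling term (`stiffnessForm_energy`). What
remains is the sum of `∫ 𝔸̃ΔF : ΔF`, `ε_p ∫ Δp²` and the stabilization, all nonnegative: by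
Rayleigh's principle the eigenvalue shift gives `𝔸̃A : A ≥ ε_λ A : A`. Hence `ΔF = 0` and `Δp = 0`.
Since `F_h` and `Σ_h` coincide as sets, `δF = ΔP` is admissible and gives `ΔP = 0`.

As `τ` may vanish, the stabilization gives no control of `(Δu, Δũ)`; this comes from the equation
tested by `δP`, which decouples into elements because stresses are discontinuous. On one element
three families of stresses suffice. The field `(div u) I` has no tangential-normal trace, so `div u
= 0`, and the Raviart–Thomas function `u` then has degree at most `k`. The bubbles `λ_i q ∇λ_j ⊗
(v_i - v_j)`, with `q` the product of the same dyad with `Grad u`, have no such trace either and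
give `Grad u = 0`. Finally, combinations of these dyads have trace proportional to `(u - ũ)_t` on
one facet and zero on the others, so `u_t = ũ_t` there (`exists_const_of_elementResidual`).

Thus `u` is constant on each element. Normal continuity, single-valuedness of `ũ` and connectedness
make it one global constant, which the essential conditions force to be zero; then `ũ = 0` because
it is tangential.

Definiteness and bilinearity both rest on continuity of the integrands on closed simplices. The
delicate one contains the pointwise smallest eigenvalue, which is continuous as a minimum over a
fixed compact sphere. -/

noncomputable section

namespace NDTNS

open MeasureTheory

/-! ### Integration over simplices and degrees of polynomials. -/

section Simplices

/-! ### Simplices with their Hausdorff measure -/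

/-- A compact set of finite measure, each of whose nonempty relatively open subsets has positive
measure. -/
structure IsSolid {X : Type*} [TopologicalSpace X] [MeasurableSpace X] (K : Set X)
    (μ : Measure X) : Prop where
  isCompact : IsCompact K
  measure_lt_top : μ K < ⊤
  measure_pos : ∀ U : Set X, IsOpen U → (U ∩ K).Nonempty → 0 < μ (U ∩ K)

section Solid

variable {X : Type*} [TopologicalSpace X] [MeasurableSpace X] [T2Space X] [BorelSpace X]
  {K : Set X} {μ : Measure X}

lemma IsSolid.integrableOn (h : IsSolid K μ) {f : X → ℝ} (hf : ContinuousOn f K) :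
    IntegrableOn f K μ :=
  hf.integrableOn_of_subset_isCompact h.isCompact h.isCompact.measurableSet subset_rfl
    h.measure_lt_top.ne

/-- The integral only gives vanishing almost everywhere. But the points of `K` where `f ≠ 0` form a
relatively open set, which would have positive measure if it were nonempty. -/
lemma IsSolid.eq_zero_of_integral_eq_zero (h : IsSolid K μ) {f : X → ℝ} (hf : ContinuousOn f K)
    (h0 : ∀ x ∈ K, 0 ≤ f x) (hint : ∫ x in K, f x ∂μ = 0) : ∀ x ∈ K, f x = 0 := by
  have hK := h.isCompact.measurableSet
  have hae := (setIntegral_eq_zero_iff_of_nonneg_ae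
    ((ae_restrict_iff' hK).2 (Filter.Eventually.of_forall h0)) (h.integrableOn hf)).1 hint
  obtain ⟨U, hU, hUK⟩ := (continuousOn_iff'.1 hf) {0}ᶜ isOpen_compl_singleton
  by_contra! hne
  obtain ⟨x, hx, hx0⟩ := hne
  refine (h.measure_pos U hU ⟨x, ?_⟩).ne' ?_
  · rw [← hUK]; exact ⟨hx0, hx⟩
  · rw [← hUK]
    have := (ae_restrict_iff' hK).1 hae
    refine measure_mono_null (fun y hy => ?_) this
    simp only [Set.mem_compl_iff, Set.mem_ofPred_eq, not_forall]
    exact ⟨hy.2, hy.1⟩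

end Solid

/-- A convex set with nonempty interior lies in the closure of that interior, so any relatively open
piece contains a nonempty open set. -/
lemma isSolid_of_convex {V : Type*} [NormedAddCommGroup V] [NormedSpace ℝ V] [MeasurableSpace V]
    (μ : Measure V) [μ.IsOpenPosMeasure] [IsFiniteMeasureOnCompacts μ] {K : Set V}
    (hK : IsCompact K) (hconv : Convex ℝ K) (hint : (interior K).Nonempty) : IsSolid K μ where
  isCompact := hK
  measure_lt_top := hK.measure_lt_top
  measure_pos U hU hne := by
    obtain ⟨x, hxU, hxK⟩ := hne
    have hx : x ∈ closure (interior K) := by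
      rw [hconv.closure_interior_eq_closure_of_nonempty_interior hint]
      exact subset_closure hxK
    have hne' : (U ∩ interior K).Nonempty := mem_closure_iff.1 hx U hU hxU
    exact ((hU.inter isOpen_interior).measure_pos μ hne').trans_le
      (measure_mono (Set.inter_subset_inter_right _ interior_subset))

lemma IsSolid.image_isometry {X Y : Type*} [MetricSpace X] [MetricSpace Y] [MeasurableSpace X]
    [MeasurableSpace Y] [BorelSpace X] [BorelSpace Y] {K : Set X} {n : ℕ}
    (h : IsSolid K (μHE[n] : Measure X)) {φ : X → Y} (hφ : Isometry φ) :
    IsSolid (φ '' K) (μHE[n] : Measure Y) where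
  isCompact := h.isCompact.image hφ.continuous
  measure_lt_top := by
    rw [hφ.euclideanHausdorffMeasure_image]; exact h.measure_lt_top
  measure_pos U hU hne := by
    rw [Set.inter_comm, ← Set.image_inter_preimage, hφ.euclideanHausdorffMeasure_image,
      Set.inter_comm]
    refine h.measure_pos _ (hU.preimage hφ.continuous) ?_
    obtain ⟨_, hyU, x, hx, rfl⟩ := hne
    exact ⟨x, hyU, hx⟩

/-- A nondegenerate `n`-simplex is solid for the `n`-dimensional Hausdorff measure. -/
lemma isSolid_simplex {d n : ℕ} {s : Finset (E d)} (hs : AffineIndependent ℝ ((↑) : s → E d))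
    (hcard : s.card = n + 1) :
    IsSolid (convexHull ℝ (s : Set (E d))) (μHE[n] : Measure (E d)) := by
  obtain ⟨p, hp⟩ : s.Nonempty := Finset.card_pos.1 (by omega)
  -- The simplex is the translate by `p` of a simplex in its `n`-dimensional direction space `V`.
  -- There it has nonempty interior, and the `n`-dimensional Hausdorff measure is Lebesgue measure.
  set V := vectorSpan ℝ (s : Set (E d)) with hV
  have hfin : Module.finrank ℝ V = n := by
    have h := hs.finrank_vectorSpan (n := n) (by simpa using hcard)
    have hr : V = vectorSpan ℝ (Set.range ((↑) : s → E d)) :=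
      congrArg (vectorSpan ℝ) Subtype.range_coe.symm
    rwa [← hr] at h
  have hφ : Isometry (fun y : V => (y : E d) + p) := by
    refine Isometry.of_dist_eq fun x y => ?_
    simp [Subtype.dist_eq]
  let q : s → V := fun x => ⟨x - p, vsub_mem_vectorSpan ℝ x.2 hp⟩
  let φ : V →ᵃ[ℝ] E d := V.subtype.toAffineMap + AffineMap.const ℝ V p
  have hφe : ∀ y, φ y = (y : E d) + p := fun y => rfl
  have hq : AffineIndependent ℝ q := by
    refine AffineIndependent.of_comp φ ?_
    convert hs using 1
    ext1 x
    simp [hφe, q]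
  have htop : affineSpan ℝ (Set.range q) = ⊤ := by
    refine (hq.affineSpan_eq_top_iff_card_eq_finrank_add_one).2 ?_
    rw [hfin]; simpa using hcard
  have himg : (fun y : V => (y : E d) + p) '' convexHull ℝ (Set.range q) =
      convexHull ℝ (s : Set (E d)) := by
    have hr : φ '' Set.range q = (s : Set (E d)) := by
      rw [← Set.range_comp]
      ext x
      constructor
      · rintro ⟨y, rfl⟩; simp [hφe, q]
      · intro hx; exact ⟨⟨x, hx⟩, by simp [hφe, q]⟩
    rw [← hr]
    exact φ.image_convexHull (Set.range q)
  rw [← himg]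
  refine IsSolid.image_isometry ?_ hφ
  have : (μHE[n] : Measure V) = volume := by
    rw [← hfin]; exact InnerProductSpace.euclideanHausdorffMeasure_eq_volume
  rw [this]
  refine isSolid_of_convex _ ?_ (convex_convexHull ℝ _) ?_
  · exact (Set.finite_range q).isCompact_convexHull ℝ
  · exact interior_convexHull_nonempty_iff_affineSpan_eq_top.2 htop

/-! ### Polynomials -/

variable {d : ℕ}

lemma continuous_ev (q : Poly d) : Continuous (ev q) :=
  (MvPolynomial.continuous_eval q).comp (by fun_prop)

lemma continuous_evV (u : Fin d → Poly d) : Continuous (evV u) :=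
  (PiLp.continuous_toLp 2 _).comp (continuous_pi fun i => continuous_ev (u i))

lemma continuous_evM (A : Matrix (Fin d) (Fin d) (Poly d)) : Continuous (evM A) :=
  continuous_matrix fun i j => continuous_ev (A i j)

/-- A polynomial that vanishes on a set with nonempty interior is zero. -/
lemma eq_zero_of_ev_eq_zero {K : Set (E d)} (hK : (interior K).Nonempty) {q : Poly d}
    (h : ∀ x ∈ K, ev q x = 0) : q = 0 := by
  obtain ⟨a, ha⟩ := hK
  have hopen : IsOpen ((WithLp.toLp 2 : (Fin d → ℝ) → E d) ⁻¹' interior K) :=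
    isOpen_interior.preimage (PiLp.continuous_toLp 2 _)
  obtain ⟨r, hr, hball⟩ := Metric.isOpen_iff.1 hopen (WithLp.ofLp a) (by simpa using ha)
  -- A ball for the sup norm of the coordinates is a product of infinite sets, on which a polynomial
  -- is determined by its values.
  refine MvPolynomial.funext_set (fun i => Metric.ball (a i) r)
    (fun i => ?_) fun x hx => ?_
  · rw [Real.ball_eq_Ioo]; exact Set.Ioo_infinite (by linarith)
  · rw [← ball_pi _ hr] at hx
    have := h _ (interior_subset (hball hx))
    simpa [ev] using this

/-- The zero polynomial also has `totalDegree` zero, so the drop in degree fails for constants and a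
vanishing derivative has to be a separate alternative. -/
lemma totalDegree_pderiv_add_one_le (q : Poly d) (i : Fin d) :
    MvPolynomial.pderiv i q = 0 ∨ (MvPolynomial.pderiv i q).totalDegree + 1 ≤ q.totalDegree := by
  by_cases h : MvPolynomial.pderiv i q = 0
  · exact Or.inl h
  refine Or.inr ?_
  obtain ⟨m, hm, hdeg⟩ := Finset.exists_mem_eq_sup _ (MvPolynomial.support_nonempty.2 h)
    (fun m : Fin d →₀ ℕ => m.sum fun _ e => e)
  rw [MvPolynomial.totalDegree, hdeg]
  have hmem : m + Finsupp.single i 1 ∈ q.support := by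
    rw [MvPolynomial.mem_support_iff, MvPolynomial.coeff_pderiv] at hm
    rw [MvPolynomial.mem_support_iff]
    exact left_ne_zero_of_mul hm
  have := MvPolynomial.le_totalDegree hmem
  rwa [Finsupp.sum_add_index' (by simp) (by simp), Finsupp.sum_single_index (by simp)] at this

lemma totalDegree_pderiv_le {q : Poly d} {k : ℕ} (hq : q.totalDegree ≤ k + 1) (i : Fin d) :
    (MvPolynomial.pderiv i q).totalDegree ≤ k := by
  rcases totalDegree_pderiv_add_one_le q i with h | h
  · simp [h]
  · omega

/-- A polynomial with vanishing gradient is constant. -/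
lemma eq_C_of_pderiv_eq_zero {q : Poly d} (h : ∀ i, MvPolynomial.pderiv i q = 0) :
    q = MvPolynomial.C (MvPolynomial.coeff 0 q) := by
  ext m
  rw [MvPolynomial.coeff_C]
  split_ifs with hm
  · rw [hm]
  · obtain ⟨i, hi⟩ : ∃ i, m i ≠ 0 := by
      by_contra! h0
      exact hm (Finsupp.ext fun i => (h0 i).symm)
    have hle : Finsupp.single i 1 ≤ m := by
      rw [Finsupp.single_le_iff]; omega
    have := MvPolynomial.coeff_pderiv (i := i) q (m - Finsupp.single i 1)
    rw [h i, tsub_add_cancel_of_le hle, MvPolynomial.coeff_zero] at this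
    rcases mul_eq_zero.1 this.symm with h1 | h1
    · exact h1
    · exact absurd h1 (by positivity)

/-- The divergence of a vector of polynomials. -/
def divPoly (u : Fin d → Poly d) : Poly d := ∑ i, MvPolynomial.pderiv i (u i)

lemma totalDegree_le_of_mem_localRT {k : ℕ} {u : Fin d → Poly d} (hu : u ∈ localRT d k)
    (i : Fin d) : (u i).totalDegree ≤ k + 1 := by
  obtain ⟨p, hp, _, ⟨q, hq, rfl⟩, rfl⟩ := Submodule.mem_sup.1 hu
  have h1 : (p i).totalDegree ≤ k :=
    (MvPolynomial.mem_restrictTotalDegree _ _ _).1 (hp i (Set.mem_univ i))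
  have h2 : q.totalDegree ≤ k := MvPolynomial.IsHomogeneous.totalDegree_le hq
  have h3 := MvPolynomial.totalDegree_mul q (MvPolynomial.X (R := ℝ) i)
  rw [MvPolynomial.totalDegree_X] at h3
  refine (MvPolynomial.totalDegree_add _ _).trans (max_le (by omega) ?_)
  exact h3.trans (by omega)

/-- A divergence-free Raviart–Thomas function of order `k` has degree at most `k`. -/
lemma totalDegree_le_of_div_eq_zero {k : ℕ} {u : Fin d → Poly d} (hd : 0 < d)
    (hu : u ∈ localRT d k) (hdiv : divPoly u = 0) (i : Fin d) : (u i).totalDegree ≤ k := by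
  obtain ⟨p, hp, _, ⟨q, hq, rfl⟩, rfl⟩ := Submodule.mem_sup.1 hu
  have hp' : ∀ i, (p i).totalDegree ≤ k := fun i =>
    (MvPolynomial.mem_restrictTotalDegree _ _ _).1 (hp i (Set.mem_univ i))
  have hq' : q.IsHomogeneous k := hq
  -- Euler's identity for homogeneous polynomials: `div (q X) = (k + d) q`.
  have hdq : divPoly (mulX d q) = ((k : ℝ) + d) • q := by
    have : ∀ i, MvPolynomial.pderiv i (mulX d q i) =
        MvPolynomial.X i * MvPolynomial.pderiv i q + q := fun i => by
      simp only [mulX, LinearMap.pi_apply, LinearMap.mulRight_apply, MvPolynomial.pderiv_mul,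
        MvPolynomial.pderiv_X_self]
      ring
    simp only [divPoly, this, Finset.sum_add_distrib, hq'.sum_X_mul_pderiv]
    simp [add_smul, Nat.cast_smul_eq_nsmul]
  have hsum : divPoly p + ((k : ℝ) + d) • q = 0 := by
    rw [← hdq, ← hdiv]; simp [divPoly, Finset.sum_add_distrib]
  -- `div p` has degree below `k`, so the degree-`k` part of `div u = 0` reads `(k + d) q = 0`, and
  -- `k + d > 0`.
  have hcomp : MvPolynomial.homogeneousComponent k (divPoly p) = 0 := by
    rw [divPoly, map_sum]
    refine Finset.sum_eq_zero fun i _ => ?_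
    rcases totalDegree_pderiv_add_one_le (p i) i with h | h
    · rw [h, map_zero]
    · exact MvPolynomial.homogeneousComponent_eq_zero _ _ (by have := hp' i; omega)
  have hq0 : q = 0 := by
    have := congrArg (MvPolynomial.homogeneousComponent k) hsum
    rw [map_add, hcomp, map_smul, map_zero, zero_add,
      MvPolynomial.homogeneousComponent_of_mem hq', if_pos rfl] at this
    refine (smul_eq_zero.1 this).resolve_left ?_
    positivity
  simpa [hq0] using hp' i

end Simplices

/-! ### Symmetry, coercivity and continuity of the shifted material tensor. -/

section Tensors

variable {d : ℕ}

/-! ### The Frobenius product -/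

lemma frob_add_left (A B D : Mat d) : frob (A + B) D = frob A D + frob B D := by
  simp [frob, add_mul, Finset.sum_add_distrib]

lemma frob_smul_left (c : ℝ) (A B : Mat d) : frob (c • A) B = c * frob A B := by
  simp [frob, Finset.mul_sum, mul_assoc]

lemma frob_comm (A B : Mat d) : frob A B = frob B A := by
  simp [frob, mul_comm]

lemma frob_add_right (A B D : Mat d) : frob A (B + D) = frob A B + frob A D := by
  rw [frob_comm, frob_add_left, frob_comm B, frob_comm D]

lemma frob_smul_right (c : ℝ) (A B : Mat d) : frob A (c • B) = c * frob A B := by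
  rw [frob_comm, frob_smul_left, frob_comm]

lemma frob_neg_left (A B : Mat d) : frob (-A) B = -frob A B := by
  simp [frob]

lemma frob_neg_right (A B : Mat d) : frob A (-B) = -frob A B := by
  simp [frob]

lemma frob_zero_left (B : Mat d) : frob 0 B = 0 := by
  simp [frob]

lemma frob_zero_right (B : Mat d) : frob B 0 = 0 := by
  simp [frob]

lemma frob_sub_left (A B D : Mat d) : frob (A - B) D = frob A D - frob B D := by
  rw [sub_eq_add_neg, frob_add_left, frob_neg_left, sub_eq_add_neg]

lemma frob_self_nonneg (A : Mat d) : 0 ≤ frob A A :=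
  Finset.sum_nonneg fun _ _ => Finset.sum_nonneg fun _ _ => mul_self_nonneg _

lemma eq_zero_of_frob_self {A : Mat d} (h : frob A A = 0) : A = 0 := by
  ext i j
  have h1 := (Finset.sum_eq_zero_iff_of_nonneg fun i _ =>
    Finset.sum_nonneg fun j _ => mul_self_nonneg (A i j)).1 h i (Finset.mem_univ i)
  have h2 := (Finset.sum_eq_zero_iff_of_nonneg fun j _ => mul_self_nonneg (A i j)).1 h1 j
    (Finset.mem_univ j)
  exact mul_self_eq_zero.1 h2

lemma continuous_frob {X : Type*} [TopologicalSpace X] {f g : X → Mat d} (hf : Continuous f)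
    (hg : Continuous g) : Continuous fun x => frob (f x) (g x) := by
  unfold frob
  exact continuous_finsetSum _ fun i _ => continuous_finsetSum _ fun j _ =>
    (hf.matrix_elem i j).mul (hg.matrix_elem i j)

lemma continuous_cof {X : Type*} [TopologicalSpace X] {f : X → Mat d} (hf : Continuous f) :
    Continuous fun x => cof (f x) :=
  hf.matrix_adjugate.matrix_transpose

/-! ### The derivative of the cofactor matrix -/

/-- In two dimensions `cof` is linear. -/
lemma cofDeriv_two (F A : Mat 2) : cofDeriv F A = cof A := by
  ext i j
  have h : (fun t : ℝ => cof (F + t • A) i j) = fun t => cof F i j + t * cof A i j := by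
    funext t
    fin_cases i <;> fin_cases j <;> simp [cof, Matrix.adjugate_fin_two] <;> ring
  simp only [cofDeriv, Matrix.of_apply, h]
  simp

/-- In three dimensions `cof` is a quadratic form in the entries, so its derivative is the
polarization. -/
lemma cofDeriv_three (F A : Mat 3) : cofDeriv F A = cof (F + A) - cof F - cof A := by
  ext i j
  have h : (fun t : ℝ => cof (F + t • A) i j) =
      fun t => cof F i j + t * (cof (F + A) - cof F - cof A) i j + t ^ 2 * cof A i j := by
    funext t
    fin_cases i <;> fin_cases j <;> simp [cof, Matrix.adjugate_fin_three] <;> ring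
  simp only [cofDeriv, Matrix.of_apply, h]
  have : HasDerivAt (fun t : ℝ => cof F i j + t * (cof (F + A) - cof F - cof A) i j +
      t ^ 2 * cof A i j) ((cof (F + A) - cof F - cof A) i j) 0 := by
    have h1 := ((hasDerivAt_id (0 : ℝ)).mul_const ((cof (F + A) - cof F - cof A) i j)).const_add
      (cof F i j)
    have h2 := ((hasDerivAt_id (0 : ℝ)).pow 2).mul_const (cof A i j)
    convert! h1.add h2 using 1
    simp
  exact this.deriv

lemma cofDeriv_add (hd : d = 2 ∨ d = 3) (F A B : Mat d) :
    cofDeriv F (A + B) = cofDeriv F A + cofDeriv F B := by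
  rcases hd with rfl | rfl
  · simp only [cofDeriv_two]
    ext i j
    fin_cases i <;> fin_cases j <;> simp [cof, Matrix.adjugate_fin_two] <;> ring
  · simp only [cofDeriv_three]
    ext i j
    fin_cases i <;> fin_cases j <;> simp [cof, Matrix.adjugate_fin_three] <;> ring

lemma cofDeriv_smul (hd : d = 2 ∨ d = 3) (F : Mat d) (c : ℝ) (A : Mat d) :
    cofDeriv F (c • A) = c • cofDeriv F A := by
  rcases hd with rfl | rfl
  · simp only [cofDeriv_two]
    ext i j
    fin_cases i <;> fin_cases j <;> simp [cof, Matrix.adjugate_fin_two]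
  · simp only [cofDeriv_three]
    ext i j
    fin_cases i <;> fin_cases j <;> simp [cof, Matrix.adjugate_fin_three] <;> ring

/-- This is the symmetry of the second derivative of `det`, whose gradient is `cof`. It makes the
material tensor self-adjoint. -/
lemma frob_cofDeriv_comm (hd : d = 2 ∨ d = 3) (F A B : Mat d) :
    frob (cofDeriv F A) B = frob (cofDeriv F B) A := by
  rcases hd with rfl | rfl
  · simp only [cofDeriv_two]
    simp [frob, cof, Matrix.adjugate_fin_two, Fin.sum_univ_two]
    ring
  · simp only [cofDeriv_three]
    simp [frob, cof, Matrix.adjugate_fin_three, Fin.sum_univ_three]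
    ring

lemma continuous_cofDeriv (hd : d = 2 ∨ d = 3) {X : Type*} [TopologicalSpace X] {f g : X → Mat d}
    (hf : Continuous f) (hg : Continuous g) : Continuous fun x => cofDeriv (f x) (g x) := by
  rcases hd with rfl | rfl
  · simp only [cofDeriv_two]
    exact continuous_cof hg
  · simp only [cofDeriv_three]
    exact ((continuous_cof (hf.add hg)).sub (continuous_cof hf)).sub (continuous_cof hg)

/-! ### The smallest eigenvalue of a symmetric tensor -/

/-- The isometry of `ℝ^{d×d}` with the Frobenius product onto a Euclidean space. -/
def vecEquiv (d : ℕ) : Mat d ≃ₗ[ℝ] EuclideanSpace ℝ (Fin d × Fin d) :=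
  (LinearEquiv.curry ℝ ℝ (Fin d) (Fin d)).symm.trans (WithLp.linearEquiv 2 ℝ _).symm

lemma vecEquiv_apply (A : Mat d) (p : Fin d × Fin d) : vecEquiv d A p = A p.1 p.2 := rfl

lemma inner_vecEquiv (A B : Mat d) : inner ℝ (vecEquiv d A) (vecEquiv d B) = frob A B := by
  simp [frob, PiLp.inner_apply, Fintype.sum_prod_type, mul_comm, vecEquiv_apply]

lemma norm_vecEquiv (A : Mat d) : ‖vecEquiv d A‖ = 1 ↔ frob A A = 1 := by
  rw [← inner_vecEquiv, real_inner_self_eq_norm_sq]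
  exact (pow_eq_one_iff_of_nonneg (norm_nonneg _) two_ne_zero).symm

lemma isCompact_frobSphere : IsCompact {A : Mat d | frob A A = 1} := by
  have h : {A : Mat d | frob A A = 1} =
      (vecEquiv d).symm.toLinearMap '' Metric.sphere (0 : EuclideanSpace ℝ (Fin d × Fin d)) 1 := by
    ext A
    simp only [Set.mem_ofPred_eq, Set.mem_image, mem_sphere_zero_iff_norm]
    constructor
    · intro hA
      exact ⟨vecEquiv d A, (norm_vecEquiv A).2 hA, by simp⟩
    · rintro ⟨x, hx, rfl⟩
      refine (norm_vecEquiv _).1 ?_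
      simpa using hx
  rw [h]
  exact (isCompact_sphere _ _).image (LinearMap.continuous_of_finiteDimensional _)

/-- Rayleigh's principle: a symmetric map attains the minimum of its quadratic form on the unit
sphere at an eigenvector. It turns an infimum over an unknown spectrum into a minimum over a fixed
compact set, which serves both coercivity and continuity in the point. -/
lemma isLeast_minEigenvalue (hd : 0 < d) (L : Mat d →ₗ[ℝ] Mat d)
    (hL : ∀ A B, frob (L A) B = frob (L B) A) :
    IsLeast ((fun A => frob (L A) A) '' {A | frob A A = 1}) (minEigenvalue L) := by
  set e := vecEquiv d
  have : Nonempty (Fin d × Fin d) := ⟨(⟨0, hd⟩, ⟨0, hd⟩)⟩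
  let T : EuclideanSpace ℝ (Fin d × Fin d) →ₗ[ℝ] EuclideanSpace ℝ (Fin d × Fin d) :=
    e.toLinearMap ∘ₗ L ∘ₗ e.symm.toLinearMap
  have hTe : ∀ A, T (e A) = e (L A) := fun A => by simp [T]
  have hT : T.IsSymmetric := by
    intro x y
    obtain ⟨A, rfl⟩ := e.surjective x
    obtain ⟨B, rfl⟩ := e.surjective y
    rw [hTe, hTe, inner_vecEquiv, inner_vecEquiv, hL, frob_comm]
  let T' := hT.toSelfAdjoint
  obtain ⟨x, hx, hmin⟩ := (isCompact_sphere (0 : EuclideanSpace ℝ (Fin d × Fin d)) 1).exists_isMinOn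
    (NormedSpace.sphere_nonempty.2 zero_le_one) T'.val.reApplyInnerSelf_continuous.continuousOn
  have hx1 : ‖x‖ = 1 := by simpa using hx
  have hx0 : x ≠ 0 := by rintro rfl; simp at hx1
  have hev := T'.prop.hasEigenvector_of_isMinOn hx0 (by rw [hx1]; exact hmin)
  obtain ⟨A, rfl⟩ := e.surjective x
  have hA1 : frob A A = 1 := (norm_vecEquiv A).1 hx1
  have hA0 : A ≠ 0 := by rintro rfl; simp at hx0
  obtain ⟨l, hl⟩ : ∃ l : ℝ, L A = l • A := by
    have h := hev.apply_eq_smul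
    change T (e A) = _ • e A at h
    rw [hTe, ← map_smul] at h
    exact ⟨_, e.injective h⟩
  have hlA : frob (L A) A = l := by rw [hl, frob_smul_left, hA1, mul_one]
  have hle : ∀ B, frob B B = 1 → l ≤ frob (L B) B := by
    intro B hB
    have h := hmin (show e B ∈ Metric.sphere 0 1 by simpa using (norm_vecEquiv B).2 hB)
    simp only [ContinuousLinearMap.reApplyInnerSelf, Set.mem_ofPred_eq] at h
    change inner ℝ (T (e A)) (e A) ≤ inner ℝ (T (e B)) (e B) at h
    rwa [hTe, hTe, inner_vecEquiv, inner_vecEquiv, hlA] at h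
  -- Any other eigenvalue is the value of the quadratic form at its normalized eigenvector. So the
  -- set of eigenvalues has a least element and its `sInf` is not a default value.
  have hleast : IsLeast {l : ℝ | ∃ A : Mat d, A ≠ 0 ∧ L A = l • A} l := by
    refine ⟨⟨A, hA0, hl⟩, ?_⟩
    rintro m ⟨B, hB0, hB⟩
    have hpos : 0 < frob B B := (frob_self_nonneg B).lt_of_ne
      fun h => hB0 (eq_zero_of_frob_self h.symm)
    have hc : (Real.sqrt (frob B B))⁻¹ * ((Real.sqrt (frob B B))⁻¹ * frob B B) = 1 := by
      have h1 := Real.sqrt_pos.2 hpos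
      nth_rewrite 3 [← Real.mul_self_sqrt hpos.le]
      field_simp
    have h := hle ((Real.sqrt (frob B B))⁻¹ • B) (by
      rw [frob_smul_left, frob_smul_right, hc])
    rw [map_smul, hB, frob_smul_left, frob_smul_right, frob_smul_left] at h
    calc l ≤ _ := h
      _ = m * ((Real.sqrt (frob B B))⁻¹ * ((Real.sqrt (frob B B))⁻¹ * frob B B)) := by ring
      _ = m := by rw [hc, mul_one]
  have hmEq : minEigenvalue L = l := hleast.csInf_eq
  rw [hmEq]
  refine ⟨⟨A, hA1, hlA⟩, ?_⟩
  rintro _ ⟨B, hB, rfl⟩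
  exact hle B hB

lemma minEigenvalue_mul_frob_le (hd : 0 < d) (L : Mat d →ₗ[ℝ] Mat d)
    (hL : ∀ A B, frob (L A) B = frob (L B) A) (B : Mat d) :
    minEigenvalue L * frob B B ≤ frob (L B) B := by
  by_cases hB0 : B = 0
  · simp [hB0, frob_zero_right]
  have hpos : 0 < frob B B := (frob_self_nonneg B).lt_of_ne
    fun h => hB0 (eq_zero_of_frob_self h.symm)
  set r := Real.sqrt (frob B B) with hr
  have hr0 : 0 < r := Real.sqrt_pos.2 hpos
  have hrr : frob B B = r * r := (Real.mul_self_sqrt hpos.le).symm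
  have h := (isLeast_minEigenvalue hd L hL).2 ⟨r⁻¹ • B, by
    simp only [Set.mem_ofPred_eq, frob_smul_left, frob_smul_right, hrr]
    field_simp, rfl⟩
  simp only [map_smul, frob_smul_left, frob_smul_right] at h
  rw [hrr]
  calc minEigenvalue L * (r * r) ≤ (r⁻¹ * (r⁻¹ * frob (L B) B)) * (r * r) := by gcongr
    _ = frob (L B) B := by field_simp

/-- The shifted tensor is uniformly positive definite. -/
lemma le_frob_shiftedTensor (hd : 0 < d) (L : Mat d →ₗ[ℝ] Mat d)
    (hL : ∀ A B, frob (L A) B = frob (L B) A) (ε : ℝ) (B : Mat d) :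
    ε * frob B B ≤ frob (shiftedTensor ε L B) B := by
  have h1 := minEigenvalue_mul_frob_le hd L hL B
  -- Coercivity only needs the second entry of the maximum: adding `ε - min λ` lifts the whole
  -- spectrum to at least `ε`.
  have h2 : ε - minEigenvalue L ≤ eigenvalueShift ε L := le_max_right _ _
  have h3 := mul_le_mul_of_nonneg_right h2 (frob_self_nonneg B)
  rw [shiftedTensor, frob_add_left, frob_smul_left]
  linarith

/-! ### The material tensor -/

/-- The material tensor as a linear map. -/
def materialMap (hd : d = 2 ∨ d = 3) (μ : ℝ) (C : ℝ → ℝ) (F : Mat d) (p : ℝ) :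
    Mat d →ₗ[ℝ] Mat d where
  toFun := materialTensor μ C F p
  map_add' A B := by
    simp only [materialTensor, cofDeriv_add hd, frob_add_right, smul_add, mul_add, add_smul]
    abel
  map_smul' c A := by
    simp only [materialTensor, cofDeriv_smul hd, frob_smul_right, RingHom.id_apply]
    module

lemma coe_materialMap (hd : d = 2 ∨ d = 3) (μ : ℝ) (C : ℝ → ℝ) (F : Mat d) (p : ℝ) :
    ⇑(materialMap hd μ C F p) = materialTensor μ C F p := rfl

lemma frob_materialMap_comm (hd : d = 2 ∨ d = 3) (μ : ℝ) (C : ℝ → ℝ) (F : Mat d) (p : ℝ)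
    (A B : Mat d) :
    frob (materialMap hd μ C F p A) B = frob (materialMap hd μ C F p B) A := by
  simp only [coe_materialMap, materialTensor, frob_sub_left, frob_smul_left, frob_add_left]
  rw [frob_cofDeriv_comm hd F A B, frob_comm A B]
  ring

lemma shiftedTensor_add (hd : d = 2 ∨ d = 3) (ε μ : ℝ) (C : ℝ → ℝ) (F : Mat d) (p : ℝ)
    (A B : Mat d) :
    shiftedTensor ε (materialTensor μ C F p) (A + B) =
      shiftedTensor ε (materialTensor μ C F p) A + shiftedTensor ε (materialTensor μ C F p) B := by
  simp only [shiftedTensor, ← coe_materialMap hd, map_add, smul_add]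
  abel

lemma shiftedTensor_smul (hd : d = 2 ∨ d = 3) (ε μ : ℝ) (C : ℝ → ℝ) (F : Mat d) (p c : ℝ)
    (A : Mat d) :
    shiftedTensor ε (materialTensor μ C F p) (c • A) =
      c • shiftedTensor ε (materialTensor μ C F p) A := by
  simp only [shiftedTensor, ← coe_materialMap hd, map_smul, smul_add, smul_comm c]

lemma le_frob_shiftedTensor_materialTensor (hd : d = 2 ∨ d = 3) (ε μ : ℝ) (C : ℝ → ℝ) (F : Mat d)
    (p : ℝ) (A : Mat d) :
    ε * frob A A ≤ frob (shiftedTensor ε (materialTensor μ C F p) A) A :=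
  le_frob_shiftedTensor (by omega) (materialMap hd μ C F p) (frob_materialMap_comm hd μ C F p) ε A

lemma IsVolumetricResponse.continuousOn_deriv {C : ℝ → ℝ} (hC : IsVolumetricResponse C) :
    ContinuousOn (deriv C) (Set.Ioi 0) :=
  hC.smooth.continuousOn_deriv_of_isOpen isOpen_Ioi (by norm_num)

lemma IsVolumetricResponse.continuousOn_deriv_deriv {C : ℝ → ℝ} (hC : IsVolumetricResponse C) :
    ContinuousOn (deriv (deriv C)) (Set.Ioi 0) :=
  (hC.smooth.deriv_of_isOpen (m := 1) isOpen_Ioi (by norm_num)).continuousOn_deriv_of_isOpen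
    isOpen_Ioi (by norm_num)

section Continuity

variable {X : Type*} [TopologicalSpace X] {C : ℝ → ℝ} {F : X → Mat d} {p : X → ℝ}

lemma continuous_comp_det {φ : ℝ → ℝ} (hφ : ContinuousOn φ (Set.Ioi 0)) (hF : Continuous F)
    (hdet : ∀ x, 0 < (F x).det) : Continuous fun x => φ (F x).det :=
  hφ.comp_continuous hF.matrix_det hdet

lemma continuous_materialTensor (hd : d = 2 ∨ d = 3) (μ : ℝ) (hC : IsVolumetricResponse C)
    (hF : Continuous F) (hp : Continuous p) (hdet : ∀ x, 0 < (F x).det) {A : X → Mat d}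
    (hA : Continuous A) : Continuous fun x => materialTensor μ C (F x) (p x) (A x) := by
  have h1 := continuous_comp_det hC.continuousOn_deriv hF hdet
  have h2 := continuous_comp_det hC.continuousOn_deriv_deriv hF hdet
  have h3 := continuous_cof hF
  exact (hA.const_smul μ).sub (hp.smul (((h2.mul (continuous_frob h3 hA)).smul h3).add
    (h1.smul (continuous_cofDeriv hd hF hA))))

/-- An infimum of a jointly continuous function over a fixed compact set depends continuously on the
parameter. -/
lemma continuous_eigenvalueShift (hd : d = 2 ∨ d = 3) (ε μ : ℝ) (hC : IsVolumetricResponse C)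
    (hF : Continuous F) (hp : Continuous p) (hdet : ∀ x, 0 < (F x).det) :
    Continuous fun x => eigenvalueShift ε (materialTensor μ C (F x) (p x)) := by
  have h : ∀ x, minEigenvalue (materialTensor μ C (F x) (p x)) =
      sInf ((fun A => frob (materialTensor μ C (F x) (p x) A) A) '' {A | frob A A = 1}) :=
    fun x => ((isLeast_minEigenvalue (by omega) (materialMap hd μ C (F x) (p x))
      (frob_materialMap_comm hd μ C (F x) (p x))).csInf_eq).symm
  simp only [eigenvalueShift, h]
  refine continuous_const.max (continuous_const.sub ?_)
  refine IsCompact.continuous_sInf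
    (f := fun x A => frob (materialTensor μ C (F x) (p x) A) A) isCompact_frobSphere ?_
  exact continuous_frob (continuous_materialTensor hd μ hC (hF.comp continuous_fst)
    (hp.comp continuous_fst) (fun z => hdet z.1) continuous_snd) continuous_snd

lemma continuous_shiftedTensor (hd : d = 2 ∨ d = 3) (ε μ : ℝ) (hC : IsVolumetricResponse C)
    (hF : Continuous F) (hp : Continuous p) (hdet : ∀ x, 0 < (F x).det) {A : X → Mat d}
    (hA : Continuous A) :
    Continuous fun x => shiftedTensor ε (materialTensor μ C (F x) (p x)) (A x) :=
  (continuous_materialTensor hd μ hC hF hp hdet hA).add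
    ((continuous_eigenvalueShift hd ε μ hC hF hp hdet).smul hA)

lemma continuous_bForm (hC : IsVolumetricResponse C) (hF : Continuous F)
    (hdet : ∀ x, 0 < (F x).det) {q : X → ℝ} (hq : Continuous q) {G : X → Mat d}
    (hG : Continuous G) : Continuous fun x => bForm C (F x) (q x) (G x) :=
  ((hq.mul (continuous_comp_det hC.continuousOn_deriv hF hdet)).mul
    (continuous_frob (continuous_cof hF) hG)).neg

end Continuity

end Tensors

/-! ### Barycentric geometry of an element: normals, tangential traces and constant dyads. -/

section Geometry

variable {d : ℕ} {M : Mesh d}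

/-! ### Barycentric coordinates of an element -/

lemma Mesh.Elem.affineIndependent (T : M.Elem) : AffineIndependent ℝ ((↑) : T.1 → E d) :=
  M.complex.indep T.2.1

lemma Mesh.Facet.affineIndependent (F : M.Facet) : AffineIndependent ℝ ((↑) : F.1 → E d) :=
  M.complex.indep F.2.1

/-- The vertices of an element as an affine basis. -/
def Mesh.Elem.basis (T : M.Elem) : AffineBasis T.1 ℝ (E d) :=
  ⟨(↑), T.affineIndependent, by
    refine (T.affineIndependent.affineSpan_eq_top_iff_card_eq_finrank_add_one).2 ?_
    simpa using T.2.2⟩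

lemma Mesh.Elem.basis_apply (T : M.Elem) (v : T.1) : T.basis v = v := rfl

lemma Mesh.Elem.isSolid (T : M.Elem) : IsSolid T.carrier (volume : Measure (E d)) := by
  have := isSolid_simplex T.affineIndependent T.2.2
  rwa [EuclideanSpace.euclideanHausdorffMeasure_eq_volume] at this

lemma Mesh.Facet.isSolid (hd : 0 < d) (F : M.Facet) :
    IsSolid F.carrier (μHE[d - 1] : Measure (E d)) :=
  isSolid_simplex F.affineIndependent (by rw [F.2.2]; omega)

lemma Mesh.Elem.interior_carrier_nonempty (T : M.Elem) : (interior T.carrier).Nonempty := by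
  refine interior_convexHull_nonempty_iff_affineSpan_eq_top.2 ?_
  have := T.basis.tot
  have hr : Set.range (T.basis : T.1 → E d) = (T.1 : Set (E d)) := by
    ext x; simp [Mesh.Elem.basis_apply]
  rwa [hr] at this

/-- The gradient of a barycentric coordinate. -/
def baryGrad (T : M.Elem) (v : T.1) : E d :=
  (InnerProductSpace.toDual ℝ (E d)).symm (LinearMap.toContinuousLinearMap (T.basis.coord v).linear)

lemma inner_baryGrad (T : M.Elem) (v : T.1) (x : E d) :
    inner ℝ (baryGrad T v) x = (T.basis.coord v).linear x := by
  simp [baryGrad]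

open Classical in
lemma coord_vertex (T : M.Elem) (v w : T.1) :
    T.basis.coord v (w : E d) = if v = w then 1 else 0 := by
  have := T.basis.coord_apply v w
  rwa [Mesh.Elem.basis_apply] at this

open Classical in
lemma inner_baryGrad_sub (T : M.Elem) (v w w' : T.1) :
    inner ℝ (baryGrad T v) ((w : E d) - w') =
      (if v = w then (1 : ℝ) else 0) - if v = w' then (1 : ℝ) else 0 := by
  rw [inner_baryGrad, ← coord_vertex, ← coord_vertex, ← vsub_eq_sub,
    AffineMap.linearMap_vsub, vsub_eq_sub]

/-- The edges at one vertex span the whole space. -/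
lemma eq_zero_of_inner_edges (T : M.Elem) (i : T.1) {x : E d}
    (h : ∀ j : T.1, inner ℝ x ((j : E d) - i) = 0) : x = 0 := by
  have hspan : Submodule.span ℝ (Set.range fun j : T.1 => (j : E d) - i) = ⊤ := by
    have h1 := vectorSpan_range_eq_span_range_vsub_right ℝ (T.basis : T.1 → E d) i
    have h2 : vectorSpan ℝ (Set.range (T.basis : T.1 → E d)) = ⊤ := by
      rw [← direction_affineSpan, T.basis.tot, AffineSubspace.direction_top]
    rw [← h2, h1]
    rfl
  have hx : x ∈ Submodule.span ℝ (Set.range fun j : T.1 => (j : E d) - i) := by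
    rw [hspan]; trivial
  refine (inner_self_eq_zero (𝕜 := ℝ)).1 ?_
  have hall : ∀ y ∈ Submodule.span ℝ (Set.range fun j : T.1 => (j : E d) - i),
      inner ℝ x y = 0 := by
    intro y hy
    induction hy using Submodule.span_induction with
    | mem y hy => obtain ⟨j, rfl⟩ := hy; exact h j
    | zero => simp
    | add y z _ _ hy hz => rw [inner_add_right, hy, hz, add_zero]
    | smul c y _ hy => rw [inner_smul_right, hy, mul_zero]
  exact hall x hx

/-- The gradients of the barycentric coordinates are dual to the edges at a vertex. -/
lemma sum_inner_smul_baryGrad (T : M.Elem) (i : T.1) (z : E d) :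
    ∑ j : T.1, inner ℝ z ((j : E d) - i) • baryGrad T j = z := by
  classical
  rw [← sub_eq_zero]
  -- Both sides have the same inner product with every edge at `i`, by duality of barycentric
  -- gradients and edges.
  refine eq_zero_of_inner_edges T i fun m => ?_
  simp only [inner_sub_left (𝕜 := ℝ) _ z, sum_inner, inner_smul_left, inner_baryGrad_sub, mul_sub,
    Finset.sum_sub_distrib]
  simp

lemma eq_zero_of_inner_baryGrad (T : M.Elem) {x : E d}
    (h : ∀ j : T.1, inner ℝ (baryGrad T j) x = 0) : x = 0 := by
  obtain ⟨i, hi⟩ : T.1.Nonempty := Finset.card_pos.1 (by rw [T.2.2]; omega)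
  refine (inner_self_eq_zero (𝕜 := ℝ)).1 ?_
  nth_rewrite 1 [← sum_inner_smul_baryGrad T ⟨i, hi⟩ x]
  rw [sum_inner]
  exact Finset.sum_eq_zero fun j _ => by rw [inner_smul_left, h j, mul_zero]

/-- A barycentric coordinate as a polynomial. -/
def baryPoly (T : M.Elem) (v : T.1) : Poly d :=
  ∑ i, MvPolynomial.C (baryGrad T v i) * MvPolynomial.X i + MvPolynomial.C (T.basis.coord v 0)

lemma ev_baryPoly (T : M.Elem) (v : T.1) (x : E d) :
    ev (baryPoly T v) x = T.basis.coord v x := by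
  have h : T.basis.coord v x = (T.basis.coord v).linear x + T.basis.coord v 0 := by
    have := (T.basis.coord v).map_vadd 0 x
    simpa using this
  rw [h, ← inner_baryGrad]
  simp [ev, baryPoly, PiLp.inner_apply, mul_comm]

lemma totalDegree_baryPoly_le (T : M.Elem) (v : T.1) : (baryPoly T v).totalDegree ≤ 1 := by
  refine (MvPolynomial.totalDegree_add _ _).trans (max_le ?_ (by simp))
  refine MvPolynomial.totalDegree_finsetSum_le fun i _ => ?_
  refine (MvPolynomial.totalDegree_mul _ _).trans ?_
  simp

lemma baryPoly_ne_zero (T : M.Elem) (v : T.1) : baryPoly T v ≠ 0 := by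
  intro h
  have := ev_baryPoly T v v
  rw [h, coord_vertex] at this
  simp [ev] at this

lemma coord_nonneg_of_mem_carrier (T : M.Elem) (v : T.1) {x : E d} (hx : x ∈ T.carrier) :
    0 ≤ T.basis.coord v x := by
  have hconv : Convex ℝ (T.basis.coord v ⁻¹' Set.Ici 0) := (convex_Ici (0 : ℝ)).affine_preimage _
  refine convexHull_min (fun w hw => ?_) hconv hx
  have := coord_vertex T v ⟨w, hw⟩
  simp only [Set.mem_preimage, Set.mem_Ici]
  rw [this]
  split_ifs <;> norm_num

/-! ### Facets and normals -/

/-- `v` is the vertex of `T` opposite to the facet `F`. -/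
def IsOpposite (T : M.Elem) (F : M.Facet) (v : T.1) : Prop := ∀ w : T.1, w.1 ∈ F.1 ↔ w ≠ v

lemma exists_isOpposite {T : M.Elem} {F : M.Facet} (h : F.IsFacetOf T) :
    ∃ v : T.1, IsOpposite T F v := by
  classical
  have hcard : (T.1 \ F.1).card = 1 := by
    rw [Finset.card_sdiff_of_subset h, T.2.2, F.2.2]; omega
  obtain ⟨v, hv⟩ := Finset.card_eq_one.1 hcard
  have hvm : v ∈ T.1 \ F.1 := by rw [hv]; simp
  refine ⟨⟨v, (Finset.mem_sdiff.1 hvm).1⟩, fun w => ?_⟩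
  constructor
  · rintro hw rfl
    exact (Finset.mem_sdiff.1 hvm).2 hw
  · intro hne
    by_contra hw
    have : w.1 ∈ T.1 \ F.1 := Finset.mem_sdiff.2 ⟨w.2, hw⟩
    rw [hv, Finset.mem_singleton] at this
    exact hne (Subtype.ext this)

lemma coord_eq_zero_of_mem_carrier {T : M.Elem} {F : M.Facet} (h : F.IsFacetOf T) {v : T.1}
    (hv : IsOpposite T F v) {x : E d} (hx : x ∈ F.carrier) : T.basis.coord v x = 0 := by
  have hconv : Convex ℝ (T.basis.coord v ⁻¹' {0}) := (convex_singleton (0 : ℝ)).affine_preimage _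
  refine convexHull_min (fun w hw => ?_) hconv hx
  have hc := coord_vertex T v ⟨w, h hw⟩
  rw [if_neg] at hc
  · exact hc
  · exact fun he => (hv ⟨w, h hw⟩).1 hw he.symm

/-- The barycentric coordinate of the opposite vertex is constant on the facet. -/
lemma baryGrad_mem_orthogonal {T : M.Elem} {F : M.Facet} (h : F.IsFacetOf T) {v : T.1}
    (hv : IsOpposite T F v) : baryGrad T v ∈ (vectorSpan ℝ (F.1 : Set (E d)))ᗮ := by
  rw [Submodule.mem_orthogonal']
  intro y hy
  rw [vectorSpan_def] at hy
  induction hy using Submodule.span_induction with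
  | mem y hy =>
    obtain ⟨a, ha, b, hb, rfl⟩ := hy
    have := inner_baryGrad_sub T v ⟨a, h ha⟩ ⟨b, h hb⟩
    rw [if_neg (((hv ⟨a, h ha⟩).1 ha).symm), if_neg (((hv ⟨b, h hb⟩).1 hb).symm)] at this
    simpa using this
  | zero => simp
  | add y z _ _ hy hz => rw [inner_add_right, hy, hz, add_zero]
  | smul c y _ hy => rw [inner_smul_right, hy, mul_zero]

lemma finrank_orthogonal_facet (hd : 0 < d) (F : M.Facet) :
    Module.finrank ℝ (vectorSpan ℝ (F.1 : Set (E d)))ᗮ = 1 := by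
  have h := F.affineIndependent.finrank_vectorSpan (n := d - 1) (by
    rw [Fintype.card_coe, F.2.2]; omega)
  have hr : vectorSpan ℝ (F.1 : Set (E d)) = vectorSpan ℝ (Set.range ((↑) : F.1 → E d)) :=
    congrArg (vectorSpan ℝ) Subtype.range_coe.symm
  have h2 := Submodule.finrank_add_finrank_orthogonal (vectorSpan ℝ (F.1 : Set (E d)))
  rw [← hr] at h
  rw [finrank_euclideanSpace_fin] at h2
  omega

lemma outerNormal_mem (T : M.Elem) (F : M.Facet) :
    outerNormal T F ∈ (vectorSpan ℝ (F.1 : Set (E d)))ᗮ :=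
  Submodule.smul_mem _ _ (Submodule.starProjection_apply_mem _ _)

/-- The point is that the vector being normalized is nonzero. Its product with the barycentric
gradient of the opposite vertex is `-1` for each of the `d` facet vertices, hence `-d` in total. -/
lemma norm_outerNormal (hd : 0 < d) {T : M.Elem} {F : M.Facet} (h : F.IsFacetOf T) :
    ‖outerNormal T F‖ = 1 := by
  classical
  obtain ⟨v, hv⟩ := exists_isOpposite h
  have hsd : T.1 \ F.1 = {v.1} := by
    ext w
    rw [Finset.mem_sdiff, Finset.mem_singleton]
    constructor
    · rintro ⟨h1, h2⟩
      by_contra hne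
      exact h2 ((hv ⟨w, h1⟩).2 fun he => hne (congrArg Subtype.val he))
    · rintro rfl
      exact ⟨v.2, fun hm => (hv v).1 hm rfl⟩
  have hg := baryGrad_mem_orthogonal h hv
  have hn : (vectorSpan ℝ (F.1 : Set (E d)))ᗮ.starProjection
      (∑ x ∈ F.1, ∑ v ∈ T.1 \ F.1, (x - v)) ≠ 0 := by
    intro h0
    have h1 : inner ℝ (baryGrad T v) (∑ x ∈ F.1, ∑ v ∈ T.1 \ F.1, (x - v)) = (0 : ℝ) := by
      rw [← Submodule.starProjection_eq_self_iff.2 hg,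
        Submodule.inner_starProjection_left_eq_right, h0, inner_zero_right]
    rw [inner_sum] at h1
    have h2 : ∀ x ∈ F.1, inner ℝ (baryGrad T v) (∑ v ∈ T.1 \ F.1, (x - v)) = (-1 : ℝ) := by
      intro x hx
      rw [hsd, Finset.sum_singleton]
      have := inner_baryGrad_sub T v ⟨x, h hx⟩ v
      rw [if_neg (((hv ⟨x, h hx⟩).1 hx).symm), if_pos rfl] at this
      simpa using this
    rw [Finset.sum_congr rfl h2] at h1
    simp [F.2.2] at h1
    omega
  change ‖‖_‖⁻¹ • _‖ = 1
  exact norm_smul_inv_norm hn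

lemma exists_smul_eq_of_mem_orthogonal (hd : 0 < d) (F : M.Facet) {x y : E d} (hx0 : x ≠ 0)
    (hx : x ∈ (vectorSpan ℝ (F.1 : Set (E d)))ᗮ) (hy : y ∈ (vectorSpan ℝ (F.1 : Set (E d)))ᗮ) :
    ∃ c : ℝ, y = c • x := by
  have := (finrank_eq_one_iff_of_nonzero' (⟨x, hx⟩ : (vectorSpan ℝ (F.1 : Set (E d)))ᗮ)
    (by simpa using hx0)).1 (finrank_orthogonal_facet hd F) ⟨y, hy⟩
  obtain ⟨c, hc⟩ := this
  exact ⟨c, (congrArg Subtype.val hc).symm⟩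

lemma baryGrad_ne_zero (hd : 0 < d) (T : M.Elem) (v : T.1) : baryGrad T v ≠ 0 := by
  intro h
  obtain ⟨w, hw, hne⟩ := Finset.exists_mem_ne (s := T.1) (by rw [T.2.2]; omega) v.1
  have := inner_baryGrad_sub T v v ⟨w, hw⟩
  rw [h, if_pos rfl, if_neg (fun he => hne (congrArg Subtype.val he).symm)] at this
  simp at this

/-- Both vectors lie on the line orthogonal to the facet. The sign of the factor plays no role
below. -/
lemma exists_outerNormal_eq_smul_baryGrad (hd : 0 < d) {T : M.Elem} {F : M.Facet}
    (h : F.IsFacetOf T) {v : T.1} (hv : IsOpposite T F v) :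
    ∃ c : ℝ, c ≠ 0 ∧ outerNormal T F = c • baryGrad T v := by
  obtain ⟨c, hc⟩ := exists_smul_eq_of_mem_orthogonal hd F (baryGrad_ne_zero hd T v)
    (baryGrad_mem_orthogonal h hv) (outerNormal_mem T F)
  refine ⟨c, ?_, hc⟩
  rintro rfl
  have := norm_outerNormal hd h
  simp [hc] at this

/-! ### Tangential parts -/

lemma tang_add (N x y : E d) : tang N (x + y) = tang N x + tang N y := by
  simp only [tang, inner_add_right, add_smul]; abel

lemma tang_smul (N : E d) (c : ℝ) (x : E d) : tang N (c • x) = c • tang N x := by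
  simp only [tang, inner_smul_right, smul_sub, mul_smul]

lemma tang_zero (N : E d) : tang N 0 = 0 := by
  simp [tang]

lemma tang_sub (N x y : E d) : tang N (x - y) = tang N x - tang N y := by
  simp only [tang, inner_sub_right, sub_smul]; abel

lemma tang_sum {ι : Type*} (s : Finset ι) (N : E d) (f : ι → E d) :
    tang N (∑ i ∈ s, f i) = ∑ i ∈ s, tang N (f i) := by
  simp only [tang, inner_sum, Finset.sum_smul, Finset.sum_sub_distrib]

lemma tang_self {N : E d} (hN : ‖N‖ = 1) : tang N N = 0 := by
  simp [tang, hN]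

/-- The factor is `±1`, and the projection is quadratic in the normal. -/
lemma tang_smul_left {N : E d} {c : ℝ} (hN : ‖N‖ = 1) (hc : ‖c • N‖ = 1) (x : E d) :
    tang (c • N) x = tang N x := by
  have h1 : c * c = 1 := by
    have : |c| = 1 := by simpa [norm_smul, hN] using hc
    rw [← abs_mul_abs_self, this, one_mul]
  simp only [tang, inner_smul_left, smul_smul]
  congr 2
  simp only [conj_trivial]
  linear_combination inner ℝ N x * h1

lemma eq_zero_of_tang_eq_zero {N x : E d} (h1 : tang N x = 0) (h2 : inner ℝ x N = 0) : x = 0 := by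
  rw [tang, real_inner_comm, h2, zero_smul, sub_zero] at h1
  exact h1

lemma continuous_tang (N : E d) : Continuous (tang N) := by
  unfold tang; fun_prop

lemma tanNormal_add (N : E d) (P Q : Mat d) :
    tanNormal N (P + Q) = tanNormal N P + tanNormal N Q := by
  simp only [tanNormal, Matrix.add_mulVec, WithLp.toLp_add, tang_add]

lemma tanNormal_smul (N : E d) (c : ℝ) (P : Mat d) :
    tanNormal N (c • P) = c • tanNormal N P := by
  simp only [tanNormal, Matrix.smul_mulVec, WithLp.toLp_smul, tang_smul]

lemma tanNormal_zero (N : E d) : tanNormal N 0 = 0 := by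
  simpa using tanNormal_smul N 0 0

lemma tanNormal_neg (N : E d) (P : Mat d) : tanNormal N (-P) = -tanNormal N P := by
  simpa using tanNormal_smul N (-1) P

lemma tanNormal_sum {ι : Type*} (s : Finset ι) (N : E d) (f : ι → Mat d) :
    tanNormal N (∑ i ∈ s, f i) = ∑ i ∈ s, tanNormal N (f i) :=
  map_sum (⟨⟨tanNormal N, tanNormal_zero N⟩, tanNormal_add N⟩ : Mat d →+ E d) f s

lemma tanNormal_one {N : E d} (hN : ‖N‖ = 1) : tanNormal N 1 = 0 := by
  simp only [tanNormal, Matrix.one_mulVec]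
  exact tang_self hN

lemma continuous_tanNormal (N : E d) : Continuous (tanNormal N) :=
  (continuous_tang N).comp ((PiLp.continuous_toLp 2 _).comp
    (continuous_id.matrix_mulVec continuous_const))

/-- The rank-one tensor `a ⊗ b`. -/
def dyad (a b : E d) : Mat d := Matrix.of fun i j => a i * b j

lemma tanNormal_dyad (N a b : E d) : tanNormal N (dyad a b) = inner ℝ b N • tang N a := by
  rw [← tang_smul, tanNormal]
  congr 1
  ext i
  simp only [dyad, Matrix.mulVec, dotProduct, Matrix.of_apply, PiLp.inner_apply, PiLp.smul_apply,
    smul_eq_mul, Finset.sum_mul]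
  exact Finset.sum_congr rfl fun j _ => by simp; ring

/-- The constant tensor `∇λ_j ⊗ (v_i - v_j)`; its tangential-normal component vanishes on all facets
but the one opposite to `v_i`. -/
def baryTensor (T : M.Elem) (i j : T.1) : Mat d := dyad (baryGrad T j) ((i : E d) - j)

/-- If `j = v`, then `∇λ_j` is normal to the facet and its tangential part vanishes. Otherwise both
`v_i` and `v_j` lie on the facet, and the edge between them is orthogonal to the normal. -/
lemma tanNormal_baryTensor_of_ne (hd : 0 < d) {T : M.Elem} {F : M.Facet} (h : F.IsFacetOf T)
    {v : T.1} (hv : IsOpposite T F v) (i j : T.1) (hi : i ≠ v) :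
    tanNormal (outerNormal T F) (baryTensor T i j) = 0 := by
  obtain ⟨c, hc, hN⟩ := exists_outerNormal_eq_smul_baryGrad hd h hv
  rw [baryTensor, tanNormal_dyad]
  by_cases hj : j = v
  · have h1 := tang_self (norm_outerNormal hd h)
    nth_rewrite 2 [hN] at h1
    rw [tang_smul] at h1
    rw [hj, (smul_eq_zero.1 h1).resolve_left hc, smul_zero]
  · rw [hN, inner_smul_right, real_inner_comm, inner_baryGrad_sub, if_neg hi.symm,
      if_neg (Ne.symm hj)]
    simp

/-- For `j ≠ v` the edge factor `(v - v_j) · N` equals the same constant `c`, so the sum reproduces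
`c` times the expansion of `z` in barycentric gradients. The term `j = v` has coefficient zero on
both sides. This allows any tangential trace to be prescribed on a single facet. -/
lemma tanNormal_sum_baryTensor (hd : 0 < d) {T : M.Elem} {F : M.Facet} (h : F.IsFacetOf T)
    {v : T.1} (hv : IsOpposite T F v) :
    ∃ c : ℝ, c ≠ 0 ∧ ∀ z : E d, tanNormal (outerNormal T F)
      (∑ j : T.1, inner ℝ z ((j : E d) - v) • baryTensor T v j) = c • tang (outerNormal T F) z := by
  obtain ⟨c, hc, hN⟩ := exists_outerNormal_eq_smul_baryGrad hd h hv
  refine ⟨c, hc, fun z => ?_⟩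
  conv_rhs => rw [← sum_inner_smul_baryGrad T v z]
  rw [tanNormal_sum, tang_sum, Finset.smul_sum]
  refine Finset.sum_congr rfl fun j _ => ?_
  rw [tanNormal_smul, tang_smul, baryTensor, tanNormal_dyad]
  by_cases hj : j = v
  · simp [hj]
  · have h1 : inner ℝ ((v : E d) - j) (outerNormal T F) = c := by
      rw [hN, inner_smul_right, real_inner_comm, inner_baryGrad_sub, if_pos rfl,
        if_neg (Ne.symm hj)]
      simp
    rw [h1, smul_comm]

/-- The product equals `Gᵀ∇λ_j · (v_i - v_j)`. The edges at `v_j` span, so `Gᵀ∇λ_j = 0`; the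
gradients span as well, so `G = 0`. -/
lemma eq_zero_of_frob_baryTensor (T : M.Elem) {G : Mat d}
    (h : ∀ i j : T.1, i ≠ j → frob (baryTensor T i j) G = 0) : G = 0 := by
  have hrow : ∀ j : T.1, (WithLp.toLp 2 (Gᵀ *ᵥ fun l => baryGrad T j l) : E d) = 0 := by
    intro j
    refine eq_zero_of_inner_edges T j fun i => ?_
    have h1 : frob (baryTensor T i j) G = 0 := by
      by_cases hij : i = j
      · subst hij
        simp [baryTensor, frob, dyad]
      · exact h i j hij
    rw [← h1]
    simp only [frob, baryTensor, dyad, Matrix.mulVec, dotProduct, Matrix.of_apply,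
      PiLp.inner_apply, Matrix.transpose_apply, RCLike.inner_apply, conj_trivial, Finset.mul_sum]
    rw [Finset.sum_comm]
    exact Finset.sum_congr rfl fun a _ => Finset.sum_congr rfl fun b _ => by ring
  ext a b
  have hcol : (WithLp.toLp 2 fun a => G a b : E d) = 0 := by
    refine eq_zero_of_inner_baryGrad T fun j => ?_
    have h2 := congrArg (fun y : E d => y b) (hrow j)
    simp only [Matrix.mulVec, dotProduct, Matrix.transpose_apply, PiLp.zero_apply] at h2
    rw [← h2]
    simp [PiLp.inner_apply]
  exact congrArg (fun y : E d => y a) hcol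

end Geometry

/-! ### Unisolvence of the stress space on one element. -/

section Unisolvence

variable {d : ℕ} {M : Mesh d}

lemma mem_facets {T : M.Elem} {F : M.Facet} : F ∈ T.facets ↔ F.IsFacetOf T := by
  simp [Mesh.Elem.facets]

lemma evM_zero (x : E d) : evM (0 : Matrix (Fin d) (Fin d) (Poly d)) x = 0 := by
  ext i j; simp [evM, ev]

lemma evM_add (A B : Matrix (Fin d) (Fin d) (Poly d)) (x : E d) :
    evM (A + B) x = evM A x + evM B x := by
  ext i j; simp [evM, ev]

lemma evM_smul (c : ℝ) (A : Matrix (Fin d) (Fin d) (Poly d)) (x : E d) :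
    evM (c • A) x = c • evM A x := by
  ext i j; simp [evM, ev, MvPolynomial.smul_eval]

lemma evM_neg (A : Matrix (Fin d) (Fin d) (Poly d)) (x : E d) :
    evM (-A) x = -evM A x := by
  ext i j; simp [evM, ev]

lemma evM_sum {ι : Type*} (s : Finset ι) (A : ι → Matrix (Fin d) (Fin d) (Poly d)) (x : E d) :
    evM (∑ i ∈ s, A i) x = ∑ i ∈ s, evM (A i) x :=
  map_sum (⟨⟨fun A => evM A x, evM_zero x⟩, fun A B => evM_add A B x⟩ :
    Matrix (Fin d) (Fin d) (Poly d) →+ Mat d) A s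

lemma evV_sub (u v : Fin d → Poly d) (x : E d) : evV (u - v) x = evV u x - evV v x := by
  ext i; simp [evV, ev]

/-- A constant tensor times a scalar polynomial. -/
def polyTensor (q : Poly d) (A : Mat d) : Matrix (Fin d) (Fin d) (Poly d) :=
  Matrix.of fun i j => q * MvPolynomial.C (A i j)

lemma evM_polyTensor (q : Poly d) (A : Mat d) (x : E d) :
    evM (polyTensor q A) x = ev q x • A := by
  ext i j; simp [evM, ev, polyTensor]

lemma polyTensor_mem {q : Poly d} {k : ℕ} (hq : q.totalDegree ≤ k) (A : Mat d) (i j : Fin d) :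
    polyTensor q A i j ∈ MvPolynomial.restrictTotalDegree (Fin d) ℝ k := by
  rw [MvPolynomial.mem_restrictTotalDegree]
  refine (MvPolynomial.totalDegree_mul _ _).trans ?_
  simpa using hq

/-- The Frobenius product of a constant tensor with a polynomial one. -/
def frobPoly (A : Mat d) (G : Matrix (Fin d) (Fin d) (Poly d)) : Poly d :=
  ∑ i, ∑ j, MvPolynomial.C (A i j) * G i j

lemma ev_frobPoly (A : Mat d) (G : Matrix (Fin d) (Fin d) (Poly d)) (x : E d) :
    ev (frobPoly A G) x = frob A (evM G x) := by
  simp [ev, frobPoly, frob, evM]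

/-- The bound is on the products `q * G i j`, not on the factors, so that vanishing entries cost
nothing. For `k = 0` a linear `q` alone would already exceed the bound. -/
lemma mul_frobPoly_totalDegree_le (q : Poly d) (A : Mat d)
    {G : Matrix (Fin d) (Fin d) (Poly d)} {k : ℕ} (h : ∀ i j, (q * G i j).totalDegree ≤ k) :
    (q * frobPoly A G).totalDegree ≤ k := by
  simp only [frobPoly, Finset.mul_sum]
  refine MvPolynomial.totalDegree_finsetSum_le fun i _ =>
    MvPolynomial.totalDegree_finsetSum_le fun j _ => ?_
  rw [mul_left_comm]
  refine (MvPolynomial.totalDegree_mul _ _).trans ?_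
  simpa using h i j

lemma frob_one_grad (u : Fin d → Poly d) (x : E d) :
    frob 1 (evM (grad u) x) = ev (divPoly u) x := by
  simp [frob, evM, grad, divPoly, ev, Matrix.one_apply]

/-- The inner product of a constant vector with a vector of polynomials. -/
def dotPoly (z : Fin d → Poly d) (a : E d) : Poly d := ∑ i, z i * MvPolynomial.C (a i)

lemma ev_dotPoly (z : Fin d → Poly d) (a x : E d) :
    ev (dotPoly z a) x = inner ℝ (evV z x) a := by
  simp [ev, dotPoly, evV, PiLp.inner_apply, mul_comm]

lemma dotPoly_totalDegree_le {z : Fin d → Poly d} {k : ℕ} (hz : ∀ i, (z i).totalDegree ≤ k)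
    (a : E d) : (dotPoly z a).totalDegree ≤ k := by
  refine MvPolynomial.totalDegree_finsetSum_le fun i _ =>
    (MvPolynomial.totalDegree_mul _ _).trans ?_
  simpa using hz i

/-! ### Unisolvence on an element -/

/-- The contribution of the element `T` to the equation tested by the stress `R`. -/
def elementResidual (T : M.Elem) (u : Fin d → Poly d) (v : M.Facet → E d → E d)
    (R : Matrix (Fin d) (Fin d) (Poly d)) : ℝ :=
  (∫ x in T.carrier, frob (evM R x) (evM (grad u) x)) -
    ∑ F ∈ T.facets, ∫ x in F.carrier, inner ℝ (tanNormal (outerNormal T F) (evM R x))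
      (tang (outerNormal T F) (evV u x)) ∂μHE[d - 1] +
    ∑ F ∈ T.facets, ∫ x in F.carrier, inner ℝ (tanNormal (outerNormal T F) (evM R x))
      (tang (outerNormal T F) (v F x)) ∂μHE[d - 1]

variable {T : M.Elem} {u : Fin d → Poly d} {v : M.Facet → E d → E d} {k : ℕ}

lemma facetIntegral_eq_zero {F : M.Facet} {R : Matrix (Fin d) (Fin d) (Poly d)}
    (htn : ∀ x ∈ F.carrier, tanNormal (outerNormal T F) (evM R x) = 0) (w : E d → E d) :
    ∫ x in F.carrier, inner ℝ (tanNormal (outerNormal T F) (evM R x)) (w x) ∂μHE[d - 1] = 0 :=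
  setIntegral_eq_zero_of_forall_eq_zero fun x hx => by rw [htn x hx, inner_zero_left]

lemma elementResidual_bubble {R : Matrix (Fin d) (Fin d) (Poly d)}
    (htn : ∀ F : M.Facet, F.IsFacetOf T → ∀ x ∈ F.carrier,
      tanNormal (outerNormal T F) (evM R x) = 0) :
    elementResidual T u v R = ∫ x in T.carrier, frob (evM R x) (evM (grad u) x) := by
  rw [elementResidual, Finset.sum_eq_zero fun F hF =>
    facetIntegral_eq_zero (htn F (mem_facets.1 hF)) _, Finset.sum_eq_zero fun F hF =>
    facetIntegral_eq_zero (htn F (mem_facets.1 hF)) _, sub_zero, add_zero]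

/-- The stress `(div u) I` has degree at most `k` and no tangential-normal trace, which leaves `∫
(div u)² = 0`. -/
lemma div_eq_zero_of_elementResidual (hd : 0 < d) (hu : u ∈ localRT d k)
    (H : ∀ R : Matrix (Fin d) (Fin d) (Poly d),
      (∀ i j, R i j ∈ MvPolynomial.restrictTotalDegree (Fin d) ℝ k) →
      elementResidual T u v R = 0) : divPoly u = 0 := by
  have hdeg : (divPoly u).totalDegree ≤ k := MvPolynomial.totalDegree_finsetSum_le fun i _ =>
    totalDegree_pderiv_le (totalDegree_le_of_mem_localRT hu i) i
  have h := H (polyTensor (divPoly u) 1) (polyTensor_mem hdeg 1)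
  rw [elementResidual_bubble fun F hF x _ => by
    rw [evM_polyTensor, tanNormal_smul, tanNormal_one (norm_outerNormal hd hF), smul_zero]] at h
  simp only [evM_polyTensor, frob_smul_left, frob_one_grad] at h
  refine eq_zero_of_ev_eq_zero T.interior_carrier_nonempty fun x hx => ?_
  have hz := T.isSolid.eq_zero_of_integral_eq_zero
    ((continuous_ev _).mul (continuous_ev _)).continuousOn (fun x _ => mul_self_nonneg _) h x hx
  exact mul_self_eq_zero.1 hz

/-- With `A = ∇λ_j ⊗ (v_i - v_j)` and `q = A : Grad u`, the stress `λ_i q A` is a bubble and the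
residual becomes `∫ λ_i q²`. -/
lemma grad_eq_zero_of_elementResidual (hd : 0 < d) (hu : u ∈ localRT d k)
    (H : ∀ R : Matrix (Fin d) (Fin d) (Poly d),
      (∀ i j, R i j ∈ MvPolynomial.restrictTotalDegree (Fin d) ℝ k) →
      elementResidual T u v R = 0) : grad u = 0 := by
  have hdeg := totalDegree_le_of_div_eq_zero hd hu (div_eq_zero_of_elementResidual hd hu H)
  have hfrob : ∀ i j : T.1, i ≠ j → frobPoly (baryTensor T i j) (grad u) = 0 := by
    intro i j hij
    set q := frobPoly (baryTensor T i j) (grad u) with hq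
    -- Since `u` has degree at most `k`, each gradient entry is zero or of degree at most `k - 1`,
    -- leaving room for the factor `λ_i`.
    have hqdeg : (baryPoly T i * q).totalDegree ≤ k := by
      refine mul_frobPoly_totalDegree_le _ _ fun a b => ?_
      rcases totalDegree_pderiv_add_one_le (u a) b with h | h
      · simp [grad, h]
      · refine (MvPolynomial.totalDegree_mul _ _).trans ?_
        have h1 := totalDegree_baryPoly_le T i
        have h2 := hdeg a
        simp only [grad, Matrix.of_apply]
        omega
    have h := H (polyTensor (baryPoly T i * q) (baryTensor T i j)) (polyTensor_mem hqdeg _)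
    rw [elementResidual_bubble fun F hF x hx => by
      rw [evM_polyTensor, tanNormal_smul]
      obtain ⟨l, hl⟩ := exists_isOpposite hF
      -- On the facet opposite `v_i` the scalar `λ_i` vanishes; on all others the trace of the
      -- constant dyad does.
      by_cases hil : i = l
      · have h0 : ev (baryPoly T i) x = 0 := by
          rw [ev_baryPoly, hil]; exact coord_eq_zero_of_mem_carrier hF hl hx
        have h1 : ev (baryPoly T i * q) x = ev (baryPoly T i) x * ev q x := by simp [ev]
        rw [h1, h0, zero_mul, zero_smul]
      · rw [tanNormal_baryTensor_of_ne hd hF hl i j hil, smul_zero]] at h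
    simp only [evM_polyTensor, frob_smul_left] at h
    simp only [← ev_frobPoly, ← hq] at h
    have hev : ∀ x, ev (baryPoly T i * q) x * ev q x = ev (baryPoly T i * q * q) x :=
      fun x => by simp [ev]
    have hz := T.isSolid.eq_zero_of_integral_eq_zero
      (f := fun x => ev (baryPoly T i * q) x * ev q x)
      ((continuous_ev _).mul (continuous_ev _)).continuousOn (fun x hx => by
        have h1 : ev (baryPoly T i * q) x * ev q x = ev (baryPoly T i) x * (ev q x * ev q x) := by
          simp [ev, mul_assoc]
        simp only [h1, ev_baryPoly]
        exact mul_nonneg (coord_nonneg_of_mem_carrier T i hx) (mul_self_nonneg _)) h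
    -- Passing to the polynomial ring, which has no zero divisors, removes the weight `λ_i`.
    have hpoly : baryPoly T i * q * q = 0 :=
      eq_zero_of_ev_eq_zero T.interior_carrier_nonempty fun x hx => by
        rw [← hev]; exact hz x hx
    rcases mul_eq_zero.1 hpoly with h1 | h1
    · exact (mul_eq_zero.1 h1).resolve_left (baryPoly_ne_zero T i)
    · exact h1
  have hpt : ∀ x, evM (grad u) x = 0 := fun x =>
    eq_zero_of_frob_baryTensor T fun i j hij => by
      rw [← ev_frobPoly, hfrob i j hij]; simp [ev]
  ext1 a b
  refine eq_zero_of_ev_eq_zero T.interior_carrier_nonempty fun x _ => ?_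
  exact congrFun (congrFun (hpt x) a) b

/-- On an element, a Raviart–Thomas function `u` and a facet function `v` annihilated by all stresses
are a constant and its tangential trace. -/
lemma exists_const_of_elementResidual (hd : 0 < d) (hu : u ∈ localRT d k)
    (hv : ∀ F : M.Facet, ∃ q : Fin d → Poly d,
      (∀ i, q i ∈ MvPolynomial.restrictTotalDegree (Fin d) ℝ k) ∧ ∀ x ∈ F.carrier, v F x = evV q x)
    (H : ∀ R : Matrix (Fin d) (Fin d) (Poly d),
      (∀ i j, R i j ∈ MvPolynomial.restrictTotalDegree (Fin d) ℝ k) →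
      elementResidual T u v R = 0) :
    ∃ c : E d, (u = fun i => MvPolynomial.C (c i)) ∧ ∀ F : M.Facet, F.IsFacetOf T →
      ∀ x ∈ F.carrier, tang (outerNormal T F) (c - v F x) = 0 := by
  have hgrad := grad_eq_zero_of_elementResidual hd hu H
  set c : E d := WithLp.toLp 2 fun i => MvPolynomial.coeff 0 (u i) with hc
  have huc : u = fun i => MvPolynomial.C (c i) := by
    funext i
    exact eq_C_of_pderiv_eq_zero fun j => congrFun (congrFun hgrad i) j
  have hev : ∀ x, evV u x = c := fun x => by
    ext i
    rw [huc]
    simp [evV, ev]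
  refine ⟨c, huc, fun F hF => ?_⟩
  obtain ⟨q, hq, hqv⟩ := hv F
  obtain ⟨l, hl⟩ := exists_isOpposite hF
  obtain ⟨a, ha, htn⟩ := tanNormal_sum_baryTensor hd hF hl
  -- A polynomial extension of `u - ũ` from the facet to the element; its degree is at most `k`
  -- because `u` is already known to be constant.
  set z : Fin d → Poly d := u - q with hz
  have hzdeg : ∀ i, (z i).totalDegree ≤ k := fun i => by
    refine (MvPolynomial.totalDegree_sub _ _).trans (max_le ?_ ?_)
    · rw [huc]; simp
    · exact (MvPolynomial.mem_restrictTotalDegree _ _ _).1 (hq i)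
  have hzF : ∀ x ∈ F.carrier, evV z x = c - v F x := fun x hx => by
    rw [hz, evV_sub, hev, hqv x hx]
  -- The stress whose tangential-normal trace is `a z_t` on `F` and zero on the other facets.
  set R : Matrix (Fin d) (Fin d) (Poly d) :=
    ∑ j : T.1, polyTensor (dotPoly z ((j : E d) - l)) (baryTensor T l j) with hR
  have hRev : ∀ x, evM R x = ∑ j : T.1, inner ℝ (evV z x) ((j : E d) - l) • baryTensor T l j :=
    fun x => by simp only [hR, evM_sum, evM_polyTensor, ev_dotPoly]
  have h := H R fun i j => by
    rw [hR, Matrix.sum_apply]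
    exact Submodule.sum_mem _ fun m _ => polyTensor_mem (dotPoly_totalDegree_le hzdeg _) _ i j
  have hother : ∀ F' ∈ T.facets, F' ≠ F → ∀ x ∈ F'.carrier,
      tanNormal (outerNormal T F') (evM R x) = 0 := by
    intro F' hF' hne x _
    rw [mem_facets] at hF'
    obtain ⟨l', hl'⟩ := exists_isOpposite hF'
    have hll : l ≠ l' := by
      rintro rfl
      refine hne (Subtype.ext (Finset.ext fun y => ?_))
      exact ⟨fun hy => (hl ⟨y, hF' hy⟩).2 ((hl' ⟨y, hF' hy⟩).1 hy),
        fun hy => (hl' ⟨y, hF hy⟩).2 ((hl ⟨y, hF hy⟩).1 hy)⟩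
    rw [hRev, tanNormal_sum]
    refine Finset.sum_eq_zero fun j _ => ?_
    rw [tanNormal_smul, tanNormal_baryTensor_of_ne hd hF' hl' l j hll, smul_zero]
  have hFm : F ∈ T.facets := mem_facets.2 hF
  rw [elementResidual, hgrad, Finset.sum_eq_single_of_mem F hFm fun F' hF' hne =>
    facetIntegral_eq_zero (hother F' hF' hne) _, Finset.sum_eq_single_of_mem F hFm
    fun F' hF' hne => facetIntegral_eq_zero (hother F' hF' hne) _] at h
  simp only [evM_zero, frob_zero_right, integral_zero, zero_sub] at h
  have hcarr : MeasurableSet F.carrier := (F.isSolid hd).isCompact.measurableSet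
  have h1 : ∀ w : Fin d → Poly d, IntegrableOn (fun x =>
      (inner ℝ (tanNormal (outerNormal T F) (evM R x)) (tang (outerNormal T F) (evV w x)) : ℝ))
      F.carrier (μHE[d - 1] : Measure (E d)) := fun w =>
    (F.isSolid hd).integrableOn (((continuous_tanNormal _).comp (continuous_evM R)).inner
      ((continuous_tang _).comp (continuous_evV w))).continuousOn
  have h2 : ∫ x in F.carrier, inner ℝ (tanNormal (outerNormal T F) (evM R x))
      (tang (outerNormal T F) (v F x)) ∂μHE[d - 1] =
      ∫ x in F.carrier, inner ℝ (tanNormal (outerNormal T F) (evM R x))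
      (tang (outerNormal T F) (evV q x)) ∂μHE[d - 1] :=
    setIntegral_congr_fun hcarr fun x hx => by simp only [hqv x hx]
  -- The two remaining facet integrals combine to `a ∫ |z_t|²`, with `a ≠ 0`.
  rw [h2, neg_add_eq_zero, ← sub_eq_zero, ← integral_sub (h1 u) (h1 q)] at h
  have h3 : ∀ x, (inner ℝ (tanNormal (outerNormal T F) (evM R x))
      (tang (outerNormal T F) (evV u x)) : ℝ) - inner ℝ (tanNormal (outerNormal T F) (evM R x))
      (tang (outerNormal T F) (evV q x)) = a * inner ℝ (tang (outerNormal T F) (evV z x))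
        (tang (outerNormal T F) (evV z x)) := fun x => by
    rw [← inner_sub_right, ← tang_sub, ← evV_sub, ← hz, hRev, htn, inner_smul_left, conj_trivial]
  simp only [h3, integral_const_mul] at h
  have h4 := (F.isSolid hd).eq_zero_of_integral_eq_zero
    (((continuous_tang _).comp (continuous_evV z)).inner
      ((continuous_tang _).comp (continuous_evV z))).continuousOn
    (fun x _ => real_inner_self_nonneg) ((mul_eq_zero.1 h).resolve_left ha)
  intro x hx
  rw [← hzF x hx]
  exact inner_self_eq_zero.1 (h4 x hx)

end Unisolvence

/-! ### Finite-dimensionality of the spaces and bilinearity of the stiffness form. -/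

section Bilinearity

variable {d : ℕ} {M : Mesh d} {k : ℕ} {ΓDn ΓDt : Set M.Facet}

/-! ### Finite-dimensionality -/

instance : FiniteDimensional ℝ (localRT d k) := by
  have h1 : (Submodule.pi Set.univ
      (fun _ : Fin d => MvPolynomial.restrictTotalDegree (Fin d) ℝ k)).FG := by
    have : ∀ _ : Fin d, Module.Finite ℝ (MvPolynomial.restrictTotalDegree (Fin d) ℝ k) :=
      fun _ => inferInstance
    exact Submodule.fg_pi fun _ => Module.Finite.iff_fg.1 inferInstance
  have h2 : (MvPolynomial.homogeneousSubmodule (Fin d) ℝ k).FG := by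
    have hle : MvPolynomial.homogeneousSubmodule (Fin d) ℝ k ≤
        MvPolynomial.restrictTotalDegree (Fin d) ℝ k := fun q hq =>
      (MvPolynomial.mem_restrictTotalDegree _ _ _).2
        (MvPolynomial.IsHomogeneous.totalDegree_le hq)
    exact Module.Finite.iff_fg.1 (Submodule.finiteDimensional_of_le hle)
  exact Module.Finite.iff_fg.2 (h1.sup (h2.map _))

instance : FiniteDimensional ℝ (displacementSpace M k ΓDn) := by
  have hle : displacementSpace M k ΓDn ≤ Submodule.pi Set.univ fun _ => localRT d k :=
    fun u hu T _ => hu.1 T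
  have : FiniteDimensional ℝ (Submodule.pi Set.univ fun _ : M.Elem => localRT d k) :=
    Module.Finite.iff_fg.2 (Submodule.fg_pi fun _ => Module.Finite.iff_fg.1 inferInstance)
  exact Submodule.finiteDimensional_of_le hle

open Classical in
/-- Restriction of polynomials to the facets, extended by zero. -/
def facetEval (M : Mesh d) : (M.Facet → Fin d → Poly d) →ₗ[ℝ] (M.Facet → E d → E d) where
  toFun q F x := if x ∈ F.carrier then evV (q F) x else 0
  map_add' q r := by
    funext F x
    by_cases h : x ∈ F.carrier <;> simp [h, evV_add]
  map_smul' c q := by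
    funext F x
    by_cases h : x ∈ F.carrier <;> simp [h, evV_smul]

instance : FiniteDimensional ℝ (facetSpace M k ΓDt) := by
  set S : Submodule ℝ (M.Facet → Fin d → Poly d) := Submodule.pi Set.univ fun _ =>
    Submodule.pi Set.univ fun _ => MvPolynomial.restrictTotalDegree (Fin d) ℝ k
  have hS : S.FG := Submodule.fg_pi fun _ => Submodule.fg_pi fun _ =>
    Module.Finite.iff_fg.1 inferInstance
  -- The polynomial representing a field on a facet is not unique, so the space is bounded by an
  -- image of polynomials; injectivity of restriction is not needed.
  have hle : facetSpace M k ΓDt ≤ S.map (facetEval M) := by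
    intro v hv
    choose q hq₁ hq₂ hq₃ using hv.1
    refine ⟨q, fun F _ i _ => hq₁ F i, ?_⟩
    funext F x
    by_cases h : x ∈ F.carrier
    · simp [facetEval, h, hq₂ F x h]
    · simp [facetEval, h, hq₃ F x h]
  have : FiniteDimensional ℝ (S.map (facetEval M)) := Module.Finite.iff_fg.2 (hS.map _)
  exact Submodule.finiteDimensional_of_le hle

instance : FiniteDimensional ℝ (stressSpace M k) := by
  let S : Submodule ℝ (Matrix (Fin d) (Fin d) (Poly d)) :=
    Submodule.pi (φ := fun _ : Fin d => Fin d → Poly d) Set.univ fun _ : Fin d =>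
      Submodule.pi Set.univ fun _ : Fin d => MvPolynomial.restrictTotalDegree (Fin d) ℝ k
  have hS : S.FG := Submodule.fg_pi (M := fun _ : Fin d => Fin d → Poly d) fun _ =>
    Submodule.fg_pi fun _ => Module.Finite.iff_fg.1 inferInstance
  have : FiniteDimensional ℝ (Submodule.pi Set.univ fun _ : M.Elem => S) :=
    Module.Finite.iff_fg.2 (Submodule.fg_pi fun _ => hS)
  have hle : stressSpace M k ≤ Submodule.pi Set.univ fun _ : M.Elem => S :=
    fun _ hP T _ i _ j _ => hP T i j
  exact Submodule.finiteDimensional_of_le hle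

/-- All entries range over the same scalar space, so transposition changes nothing. This later
permits `ΔP` as a test function `δF`. -/
lemma defGradSpace_eq_stressSpace : defGradSpace M k = stressSpace M k :=
  Submodule.ext fun _ => ⟨fun h T i j => h T j i, fun h T i j => h T j i⟩

instance : FiniteDimensional ℝ (defGradSpace M k) :=
  Submodule.finiteDimensional_of_le defGradSpace_eq_stressSpace.le

instance : FiniteDimensional ℝ (pressureSpace M k) :=
  Module.Finite.iff_fg.2 (Submodule.fg_pi fun _ => Module.Finite.iff_fg.1 inferInstance)

/-! ### Integrals over the mesh -/

/-- Continuity on the compact elements supplies the integrability that additivity of the integral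
requires. -/
lemma domainIntegral_isLinearMap {W : Type*} [AddCommGroup W] [Module ℝ W]
    {g : W → M.Elem → E d → ℝ} (hadd : ∀ w w' T x, g (w + w') T x = g w T x + g w' T x)
    (hsmul : ∀ (c : ℝ) w T x, g (c • w) T x = c * g w T x)
    (hcont : ∀ w T, ContinuousOn (g w T) T.carrier) :
    IsLinearMap ℝ fun w => domainIntegral (g w) where
  map_add w w' := by
    simp only [domainIntegral, hadd, ← Finset.sum_add_distrib]
    exact Finset.sum_congr rfl fun T _ => integral_add (T.isSolid.integrableOn (hcont w T))
      (T.isSolid.integrableOn (hcont w' T))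
  map_smul c w := by
    simp only [domainIntegral, hsmul, integral_const_mul, smul_eq_mul, Finset.mul_sum]

lemma boundaryIntegral_isLinearMap (hd : 0 < d) {W : Type*} [AddCommGroup W] [Module ℝ W]
    {g : W → M.Elem → M.Facet → E d → ℝ}
    (hadd : ∀ w w' T F x, g (w + w') T F x = g w T F x + g w' T F x)
    (hsmul : ∀ (c : ℝ) w T F x, g (c • w) T F x = c * g w T F x)
    (hcont : ∀ w T F, ContinuousOn (g w T F) F.carrier) :
    IsLinearMap ℝ fun w => boundaryIntegral (g w) where
  map_add w w' := by
    simp only [boundaryIntegral, hadd, ← Finset.sum_add_distrib]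
    exact Finset.sum_congr rfl fun T _ => Finset.sum_congr rfl fun F _ =>
      integral_add ((F.isSolid hd).integrableOn (hcont w T F))
        ((F.isSolid hd).integrableOn (hcont w' T F))
  map_smul c w := by
    simp only [boundaryIntegral, hsmul, integral_const_mul, smul_eq_mul, Finset.mul_sum]

lemma domainIntegral_add {f g : M.Elem → E d → ℝ} (hf : ∀ T, ContinuousOn (f T) T.carrier)
    (hg : ∀ T, ContinuousOn (g T) T.carrier) :
    domainIntegral (fun T x => f T x + g T x) = domainIntegral f + domainIntegral g := by
  simp only [domainIntegral, ← Finset.sum_add_distrib]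
  exact Finset.sum_congr rfl fun T _ => integral_add (T.isSolid.integrableOn (hf T))
    (T.isSolid.integrableOn (hg T))

lemma domainIntegral_neg (f : M.Elem → E d → ℝ) :
    domainIntegral (fun T x => -f T x) = -domainIntegral f := by
  simp only [domainIntegral, integral_neg, Finset.sum_neg_distrib]

lemma boundaryIntegral_neg (f : M.Elem → M.Facet → E d → ℝ) :
    boundaryIntegral (fun T F x => -f T F x) = -boundaryIntegral f := by
  simp only [boundaryIntegral, integral_neg, Finset.sum_neg_distrib]

lemma domainIntegral_zero : domainIntegral (fun (_ : M.Elem) (_ : E d) => 0) = 0 := by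
  simp [domainIntegral]

lemma boundaryIntegral_zero :
    boundaryIntegral (fun (_ : M.Elem) (_ : M.Facet) (_ : E d) => 0) = 0 := by
  simp [boundaryIntegral]

lemma domainIntegral_nonneg {f : M.Elem → E d → ℝ} (h0 : ∀ T, ∀ x ∈ T.carrier, 0 ≤ f T x) :
    0 ≤ domainIntegral f :=
  Finset.sum_nonneg fun T _ => setIntegral_nonneg T.isSolid.isCompact.measurableSet (h0 T)

lemma boundaryIntegral_nonneg {f : M.Elem → M.Facet → E d → ℝ} (h0 : ∀ T F x, 0 ≤ f T F x) :
    0 ≤ boundaryIntegral f :=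
  Finset.sum_nonneg fun T _ => Finset.sum_nonneg fun F _ => integral_nonneg (h0 T F)

lemma eq_zero_of_domainIntegral_eq_zero {f : M.Elem → E d → ℝ}
    (hf : ∀ T, ContinuousOn (f T) T.carrier) (h0 : ∀ T, ∀ x ∈ T.carrier, 0 ≤ f T x)
    (h : domainIntegral f = 0) (T : M.Elem) : ∀ x ∈ T.carrier, f T x = 0 := by
  have hT := (Finset.sum_eq_zero_iff_of_nonneg fun (T : M.Elem) _ =>
    setIntegral_nonneg T.isSolid.isCompact.measurableSet (h0 T)).1 h T (Finset.mem_univ T)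
  exact T.isSolid.eq_zero_of_integral_eq_zero (hf T) (h0 T) hT

lemma eq_zero_of_evM_eq_zero {T : M.Elem} {A : Matrix (Fin d) (Fin d) (Poly d)}
    (h : ∀ x ∈ T.carrier, evM A x = 0) : A = 0 := by
  ext1 i j
  exact eq_zero_of_ev_eq_zero T.interior_carrier_nonempty fun x hx =>
    congrFun (congrFun (h x hx) i) j

/-! ### Bilinearity of the stiffness form -/

lemma ev_add (p q : Poly d) (x : E d) : ev (p + q) x = ev p x + ev q x := by simp [ev]

lemma ev_smul (c : ℝ) (p : Poly d) (x : E d) : ev (c • p) x = c * ev p x := by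
  simp [ev, MvPolynomial.smul_eval]

lemma ev_zero (x : E d) : ev (0 : Poly d) x = 0 := by simp [ev]

lemma ev_neg (p : Poly d) (x : E d) : ev (-p) x = -ev p x := by simp [ev]

lemma grad_add (u v : Fin d → Poly d) : grad (u + v) = grad u + grad v := by
  ext1 i j; simp [grad]

lemma grad_smul (c : ℝ) (u : Fin d → Poly d) : grad (c • u) = c • grad u := by
  ext1 i j; simp [grad]

lemma grad_zero : grad (0 : Fin d → Poly d) = 0 := by
  ext1 i j; simp [grad]

namespace Fields

variable (w w' : Fields M k ΓDn ΓDt) (c : ℝ) (T : M.Elem) (F : M.Facet) (x : E d)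

lemma u_add : (w + w').u T = w.u T + w'.u T := rfl
lemma u_smul : (c • w).u T = c • w.u T := rfl
lemma uHyb_add : (w + w').uHyb F x = w.uHyb F x + w'.uHyb F x := rfl
lemma uHyb_smul : (c • w).uHyb F x = c • w.uHyb F x := rfl
lemma F_add : (w + w').F T = w.F T + w'.F T := rfl
lemma F_smul : (c • w).F T = c • w.F T := rfl
lemma P_add : (w + w').P T = w.P T + w'.P T := rfl
lemma P_smul : (c • w).P T = c • w.P T := rfl
lemma p_add : (w + w').p T = w.p T + w'.p T := rfl
lemma p_smul : (c • w).p T = c • w.p T := rfl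

/-- Continuity is relative to the facet, since the extension by zero is in general discontinuous on
the whole space. -/
lemma continuousOn_uHyb : ContinuousOn (w.uHyb F) F.carrier := by
  obtain ⟨q, -, hq, -⟩ := w.2.1.2.1 F
  exact (continuous_evV q).continuousOn.congr hq

end Fields

lemma bForm_add_left (C : ℝ → ℝ) (F : Mat d) (p q : ℝ) (G : Mat d) :
    bForm C F (p + q) G = bForm C F p G + bForm C F q G := by
  simp only [bForm]; ring

lemma bForm_mul_left (C : ℝ → ℝ) (F : Mat d) (c p : ℝ) (G : Mat d) :
    bForm C F (c * p) G = c * bForm C F p G := by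
  simp only [bForm]; ring

lemma bForm_add_right (C : ℝ → ℝ) (F : Mat d) (p : ℝ) (G H : Mat d) :
    bForm C F p (G + H) = bForm C F p G + bForm C F p H := by
  simp only [bForm, frob_add_right]; ring

lemma bForm_smul_right (C : ℝ → ℝ) (F : Mat d) (p c : ℝ) (G : Mat d) :
    bForm C F p (c • G) = c * bForm C F p G := by
  simp only [bForm, frob_smul_right]; ring

lemma continuous_frob_evM (A B : Matrix (Fin d) (Fin d) (Poly d)) :
    Continuous fun x => frob (evM A x) (evM B x) :=
  continuous_frob (continuous_evM A) (continuous_evM B)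

section IsLinearMap

variable {W : Type*} [AddCommGroup W] [Module ℝ W] {f g : W → ℝ}

lemma isLinearMap_add (hf : IsLinearMap ℝ f) (hg : IsLinearMap ℝ g) :
    IsLinearMap ℝ fun w => f w + g w :=
  (hf.mk' f + hg.mk' g).isLinear

lemma isLinearMap_sub (hf : IsLinearMap ℝ f) (hg : IsLinearMap ℝ g) :
    IsLinearMap ℝ fun w => f w - g w :=
  (hf.mk' f - hg.mk' g).isLinear

lemma isLinearMap_neg (hf : IsLinearMap ℝ f) : IsLinearMap ℝ fun w => -f w :=
  (-hf.mk' f).isLinear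

end IsLinearMap

section Forms

variable {π : Params M} {s : Fields M k ∅ ∅}

lemma continuousOn_frob_shiftedTensor (hd : d = 2 ∨ d = 3) (hC : IsVolumetricResponse π.C)
    (hJ : ∀ T : M.Elem, ∀ x ∈ T.carrier, 0 < (evM (s.F T) x).det) (T : M.Elem)
    (A B : Matrix (Fin d) (Fin d) (Poly d)) :
    ContinuousOn (fun x => frob (shiftedTensor π.εlam
      (materialTensor π.μ π.C (evM (s.F T) x) (ev (s.p T) x)) (evM A x)) (evM B x))
      T.carrier := by
  -- The determinant is known to be positive only on the closed element, so the argument runs on the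
  -- subtype.
  rw [continuousOn_iff_continuous_domRestrict]
  exact continuous_frob (continuous_shiftedTensor hd π.εlam π.μ hC
    ((continuous_evM _).comp continuous_subtype_val)
    ((continuous_ev _).comp continuous_subtype_val) (fun x : T.carrier => hJ T x x.2)
    ((continuous_evM A).comp continuous_subtype_val))
    ((continuous_evM B).comp continuous_subtype_val)

lemma continuousOn_bForm (hC : IsVolumetricResponse π.C)
    (hJ : ∀ T : M.Elem, ∀ x ∈ T.carrier, 0 < (evM (s.F T) x).det) (T : M.Elem)
    (q : Poly d) (G : Matrix (Fin d) (Fin d) (Poly d)) :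
    ContinuousOn (fun x => bForm π.C (evM (s.F T) x) (ev q x) (evM G x)) T.carrier := by
  rw [continuousOn_iff_continuous_domRestrict]
  exact continuous_bForm hC ((continuous_evM _).comp continuous_subtype_val)
    (fun x : T.carrier => hJ T x x.2) ((continuous_ev q).comp continuous_subtype_val)
    ((continuous_evM G).comp continuous_subtype_val)

variable (w δ : Fields M k ΓDn ΓDt)

lemma equationF_isLinearMap_left (hd : d = 2 ∨ d = 3) (hC : IsVolumetricResponse π.C)
    (hJ : ∀ T : M.Elem, ∀ x ∈ T.carrier, 0 < (evM (s.F T) x).det) :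
    IsLinearMap ℝ fun w => equationF π s w δ := by
  refine domainIntegral_isLinearMap (fun w w' T x => ?_) (fun c w T x => ?_) fun w T => ?_
  · simp only [Fields.F_add, Fields.p_add, Fields.P_add, evM_add, ev_add, shiftedTensor_add hd,
      frob_add_left, bForm_add_left]
    ring
  · simp only [Fields.F_smul, Fields.p_smul, Fields.P_smul, evM_smul, ev_smul,
      shiftedTensor_smul hd, frob_smul_left, bForm_mul_left]
    ring
  · exact ((continuousOn_frob_shiftedTensor hd hC hJ T _ _).add
      (continuousOn_bForm hC hJ T _ _)).sub (continuous_frob_evM _ _).continuousOn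

lemma equationF_isLinearMap_right (hd : d = 2 ∨ d = 3) (hC : IsVolumetricResponse π.C)
    (hJ : ∀ T : M.Elem, ∀ x ∈ T.carrier, 0 < (evM (s.F T) x).det) :
    IsLinearMap ℝ fun δ => equationF π s w δ := by
  refine domainIntegral_isLinearMap (fun δ δ' T x => ?_) (fun c δ T x => ?_) fun δ T => ?_
  · simp only [Fields.F_add, evM_add, frob_add_right, bForm_add_right]
    ring
  · simp only [Fields.F_smul, evM_smul, frob_smul_right, bForm_smul_right]
    ring
  · exact ((continuousOn_frob_shiftedTensor hd hC hJ T _ _).add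
      (continuousOn_bForm hC hJ T _ _)).sub (continuous_frob_evM _ _).continuousOn

lemma continuousOn_equationp (hC : IsVolumetricResponse π.C)
    (hJ : ∀ T : M.Elem, ∀ x ∈ T.carrier, 0 < (evM (s.F T) x).det) (T : M.Elem) :
    ContinuousOn (fun x => bForm π.C (evM (s.F T) x) (ev (δ.p T) x) (evM (w.F T) x) -
      π.εp * ev (w.p T) x * ev (δ.p T) x) T.carrier :=
  (continuousOn_bForm hC hJ T _ _).sub
    ((continuous_const.mul (continuous_ev _)).mul (continuous_ev _)).continuousOn

lemma equationp_isLinearMap_left (hC : IsVolumetricResponse π.C)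
    (hJ : ∀ T : M.Elem, ∀ x ∈ T.carrier, 0 < (evM (s.F T) x).det) :
    IsLinearMap ℝ fun w => equationp π s w δ := by
  refine domainIntegral_isLinearMap (fun w w' T x => ?_) (fun c w T x => ?_)
    fun w => continuousOn_equationp w δ hC hJ
  · simp only [Fields.F_add, Fields.p_add, evM_add, ev_add, bForm_add_right]
    ring
  · simp only [Fields.F_smul, Fields.p_smul, evM_smul, ev_smul, bForm_smul_right]
    ring

lemma equationp_isLinearMap_right (hC : IsVolumetricResponse π.C)
    (hJ : ∀ T : M.Elem, ∀ x ∈ T.carrier, 0 < (evM (s.F T) x).det) :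
    IsLinearMap ℝ fun δ => equationp π s w δ := by
  refine domainIntegral_isLinearMap (fun δ δ' T x => ?_) (fun c δ T x => ?_)
    fun δ => continuousOn_equationp w δ hC hJ
  · simp only [Fields.p_add, ev_add, bForm_add_left]
    ring
  · simp only [Fields.p_smul, ev_smul, bForm_mul_left]
    ring

lemma continuous_inner_tanNormal_tang (N : E d) (R : Matrix (Fin d) (Fin d) (Poly d))
    (u : Fin d → Poly d) :
    Continuous fun x => (inner ℝ (tanNormal N (evM R x)) (tang N (evV u x)) : ℝ) :=
  ((continuous_tanNormal N).comp (continuous_evM R)).inner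
    ((continuous_tang N).comp (continuous_evV u))

lemma continuousOn_inner_tanNormal_tang_uHyb (N : E d) (R : Matrix (Fin d) (Fin d) (Poly d))
    (F : M.Facet) :
    ContinuousOn (fun x => (inner ℝ (tanNormal N (evM R x)) (tang N (w.uHyb F x)) : ℝ))
      F.carrier :=
  ((continuous_tanNormal N).comp (continuous_evM R)).continuousOn.inner
    ((continuous_tang N).comp_continuousOn (w.continuousOn_uHyb F))

lemma gradPairing_isLinearMap_left (hd : 0 < d)
    (P : M.Elem → Matrix (Fin d) (Fin d) (Poly d)) :
    IsLinearMap ℝ fun w : Fields M k ΓDn ΓDt => gradPairing w.u P := by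
  refine isLinearMap_sub (domainIntegral_isLinearMap (fun w w' T x => ?_) (fun c w T x => ?_)
      fun w T => (continuous_frob_evM _ _).continuousOn)
    (boundaryIntegral_isLinearMap hd (fun w w' T F x => ?_) (fun c w T F x => ?_)
      fun w T F => (continuous_inner_tanNormal_tang _ _ _).continuousOn)
  · simp only [Fields.u_add, grad_add, evM_add, frob_add_right]
  · simp only [Fields.u_smul, grad_smul, evM_smul, frob_smul_right]
  · simp only [Fields.u_add, evV_add, tang_add, inner_add_right]
  · simp only [Fields.u_smul, evV_smul, tang_smul, inner_smul_right]

lemma gradPairing_isLinearMap_right (hd : 0 < d) (u : M.Elem → Fin d → Poly d) :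
    IsLinearMap ℝ fun w : Fields M k ΓDn ΓDt => gradPairing u w.P := by
  refine isLinearMap_sub (domainIntegral_isLinearMap (fun w w' T x => ?_) (fun c w T x => ?_)
      fun w T => (continuous_frob_evM _ _).continuousOn)
    (boundaryIntegral_isLinearMap hd (fun w w' T F x => ?_) (fun c w T F x => ?_)
      fun w T F => (continuous_inner_tanNormal_tang _ _ _).continuousOn)
  · simp only [Fields.P_add, evM_add, frob_add_left]
  · simp only [Fields.P_smul, evM_smul, frob_smul_left]
  · simp only [Fields.P_add, evM_add, tanNormal_add, inner_add_left]
  · simp only [Fields.P_smul, evM_smul, tanNormal_smul, inner_smul_left, conj_trivial]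

lemma hybPairing_isLinearMap_left (hd : 0 < d)
    (P : M.Elem → Matrix (Fin d) (Fin d) (Poly d)) :
    IsLinearMap ℝ fun w : Fields M k ΓDn ΓDt => hybPairing w.uHyb P := by
  refine boundaryIntegral_isLinearMap hd (fun w w' T F x => ?_) (fun c w T F x => ?_)
    fun w T F => continuousOn_inner_tanNormal_tang_uHyb w _ _ F
  · simp only [Fields.uHyb_add, tang_add, inner_add_right]
  · simp only [Fields.uHyb_smul, tang_smul, inner_smul_right]

lemma hybPairing_isLinearMap_right (hd : 0 < d) :
    IsLinearMap ℝ fun δ : Fields M k ΓDn ΓDt => hybPairing w.uHyb δ.P := by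
  refine boundaryIntegral_isLinearMap hd (fun δ δ' T F x => ?_) (fun c δ T F x => ?_)
    fun δ T F => continuousOn_inner_tanNormal_tang_uHyb w _ _ F
  · simp only [Fields.P_add, evM_add, tanNormal_add, inner_add_left]
  · simp only [Fields.P_smul, evM_smul, tanNormal_smul, inner_smul_left, conj_trivial]

lemma equationP_isLinearMap_left (hd : 0 < d) :
    IsLinearMap ℝ fun w => equationP w δ := by
  refine isLinearMap_add (isLinearMap_add (isLinearMap_neg (domainIntegral_isLinearMap
    (fun w w' T x => ?_) (fun c w T x => ?_) fun w T => (continuous_frob_evM _ _).continuousOn))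
    (gradPairing_isLinearMap_left hd _)) (hybPairing_isLinearMap_left hd _)
  · simp only [Fields.F_add, evM_add, frob_add_left]
  · simp only [Fields.F_smul, evM_smul, frob_smul_left]

lemma equationP_isLinearMap_right (hd : 0 < d) :
    IsLinearMap ℝ fun δ => equationP w δ := by
  refine isLinearMap_add (isLinearMap_add (isLinearMap_neg (domainIntegral_isLinearMap
    (fun δ δ' T x => ?_) (fun c δ T x => ?_) fun δ T => (continuous_frob_evM _ _).continuousOn))
    (gradPairing_isLinearMap_right hd _)) (hybPairing_isLinearMap_right w hd)
  · simp only [Fields.P_add, evM_add, frob_add_right]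
  · simp only [Fields.P_smul, evM_smul, frob_smul_right]

lemma continuousOn_tang_sub_uHyb (T : M.Elem) (F : M.Facet) :
    ContinuousOn (fun x => tang (outerNormal T F) (evV (w.u T) x - w.uHyb F x)) F.carrier :=
  (continuous_tang _).comp_continuousOn
    ((continuous_evV _).continuousOn.sub (w.continuousOn_uHyb F))

lemma continuousOn_stabilization (T : M.Elem) (F : M.Facet) :
    ContinuousOn (fun x => π.τ T F *
      inner ℝ (tang (outerNormal T F) (evV (w.u T) x - w.uHyb F x))
        (tang (outerNormal T F) (evV (δ.u T) x - δ.uHyb F x))) F.carrier :=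
  continuousOn_const.mul
    ((continuousOn_tang_sub_uHyb w T F).inner (continuousOn_tang_sub_uHyb δ T F))

lemma equationU_isLinearMap_left (hd : 0 < d) :
    IsLinearMap ℝ fun w => equationU π w δ := by
  -- In this equation the increment enters the pairings through `ΔP`, that is, in their second slot.
  refine isLinearMap_add (isLinearMap_add (gradPairing_isLinearMap_right hd _)
    (hybPairing_isLinearMap_right δ hd)) (boundaryIntegral_isLinearMap hd
    (fun w w' T F x => ?_) (fun c w T F x => ?_) fun w T F => continuousOn_stabilization w δ T F)
  · simp only [Fields.u_add, Fields.uHyb_add, evV_add, add_sub_add_comm, tang_add, inner_add_left,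
      mul_add]
  · simp only [Fields.u_smul, Fields.uHyb_smul, evV_smul, ← smul_sub, tang_smul, inner_smul_left,
      conj_trivial]
    ring

lemma equationU_isLinearMap_right (hd : 0 < d) :
    IsLinearMap ℝ fun δ => equationU π w δ := by
  refine isLinearMap_add (isLinearMap_add (gradPairing_isLinearMap_left hd _)
    (hybPairing_isLinearMap_left hd _)) (boundaryIntegral_isLinearMap hd
    (fun δ δ' T F x => ?_) (fun c δ T F x => ?_) fun δ T F => continuousOn_stabilization w δ T F)
  · simp only [Fields.u_add, Fields.uHyb_add, evV_add, add_sub_add_comm, tang_add,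
      inner_add_right, mul_add]
  · simp only [Fields.u_smul, Fields.uHyb_smul, evV_smul, ← smul_sub, tang_smul, inner_smul_right]
    ring

lemma stiffnessForm_isLinearMap_left (hd : d = 2 ∨ d = 3) (hC : IsVolumetricResponse π.C)
    (hJ : ∀ T : M.Elem, ∀ x ∈ T.carrier, 0 < (evM (s.F T) x).det) :
    IsLinearMap ℝ fun w => stiffnessForm π s w δ :=
  have hd' : 0 < d := by omega
  isLinearMap_add (isLinearMap_add (isLinearMap_add (equationF_isLinearMap_left δ hd hC hJ)
    (equationp_isLinearMap_left δ hC hJ)) (equationP_isLinearMap_left δ hd'))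
    (equationU_isLinearMap_left δ hd')

lemma stiffnessForm_isLinearMap_right (hd : d = 2 ∨ d = 3) (hC : IsVolumetricResponse π.C)
    (hJ : ∀ T : M.Elem, ∀ x ∈ T.carrier, 0 < (evM (s.F T) x).det) :
    IsLinearMap ℝ fun δ => stiffnessForm π s w δ :=
  have hd' : 0 < d := by omega
  isLinearMap_add (isLinearMap_add (isLinearMap_add (equationF_isLinearMap_right w hd hC hJ)
    (equationp_isLinearMap_right w hC hJ)) (equationP_isLinearMap_right w hd'))
    (equationU_isLinearMap_right w hd')

end Forms

end Bilinearity

/-! ### Triviality of the kernel of the stiffness form. -/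

section Nondegeneracy

variable {d : ℕ} {M : Mesh d} {k : ℕ} {ΓDn ΓDt : Set M.Facet}

/-! ### The kernel of the stiffness form -/

lemma gradPairing_neg_right (u : M.Elem → Fin d → Poly d)
    (P : M.Elem → Matrix (Fin d) (Fin d) (Poly d)) :
    gradPairing u (-P) = -gradPairing u P := by
  simp only [gradPairing, Pi.neg_apply, evM_neg, frob_neg_left, tanNormal_neg, inner_neg_left,
    domainIntegral_neg, boundaryIntegral_neg]
  ring

lemma hybPairing_neg_right (v : M.Facet → E d → E d)
    (P : M.Elem → Matrix (Fin d) (Fin d) (Poly d)) :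
    hybPairing v (-P) = -hybPairing v P := by
  simp only [hybPairing, Pi.neg_apply, evM_neg, tanNormal_neg, inner_neg_left,
    boundaryIntegral_neg]

lemma gradPairing_zero_left (P : M.Elem → Matrix (Fin d) (Fin d) (Poly d)) :
    gradPairing 0 P = 0 := by
  simp only [gradPairing, Pi.zero_apply, grad_zero, evM_zero, frob_zero_right, evV_zero, tang_zero,
    inner_zero_right, domainIntegral_zero, boundaryIntegral_zero, sub_zero]

lemma gradPairing_zero_right (u : M.Elem → Fin d → Poly d) : gradPairing u 0 = 0 := by
  simp only [gradPairing, Pi.zero_apply, evM_zero, frob_zero_left, tanNormal_zero,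
    inner_zero_left, domainIntegral_zero, boundaryIntegral_zero, sub_zero]

lemma hybPairing_zero_left (P : M.Elem → Matrix (Fin d) (Fin d) (Poly d)) :
    hybPairing 0 P = 0 := by
  simp only [hybPairing, Pi.zero_apply, tang_zero, inner_zero_right, boundaryIntegral_zero]

lemma hybPairing_zero_right (v : M.Facet → E d → E d) : hybPairing v 0 = 0 := by
  simp only [hybPairing, Pi.zero_apply, evM_zero, tanNormal_zero, inner_zero_left,
    boundaryIntegral_zero]

/-- A stress supported on a single element is admissible, so the compatibility equation localizes.
-/
lemma pairing_single (u : M.Elem → Fin d → Poly d) (v : M.Facet → E d → E d) (T : M.Elem)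
    (R : Matrix (Fin d) (Fin d) (Poly d)) [DecidableEq M.Elem] :
    gradPairing u (Pi.single T R) + hybPairing v (Pi.single T R) =
      elementResidual T (u T) v R := by
  have hne : ∀ T' : M.Elem, T' ≠ T →
      (Pi.single T R : M.Elem → Matrix (Fin d) (Fin d) (Poly d)) T' = 0 :=
    fun T' h => by rw [Pi.single_eq_of_ne h]
  rw [gradPairing, hybPairing, domainIntegral, boundaryIntegral, boundaryIntegral,
    elementResidual, Fintype.sum_eq_single T fun T' h => ?_, Fintype.sum_eq_single T fun T' h => ?_,
    Fintype.sum_eq_single T fun T' h => ?_]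
  · simp only [Pi.single_eq_same]
  all_goals simp only [hne T' h, evM_zero, frob_zero_left, tanNormal_zero, inner_zero_left,
    integral_zero, Finset.sum_const_zero]

section Kernel

variable {π : Params M} {s : Fields M k ∅ ∅} {w : Fields M k ΓDn ΓDt}

/-- Testing with `(Δu, Δũ, ΔF, -ΔP, -Δp)` leaves only the coercive terms. -/
lemma stiffnessForm_energy (hd : d = 2 ∨ d = 3) (hC : IsVolumetricResponse π.C)
    (hJ : ∀ T : M.Elem, ∀ x ∈ T.carrier, 0 < (evM (s.F T) x).det) (w : Fields M k ΓDn ΓDt) :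
    stiffnessForm π s w (w.1, w.2.1, w.2.2.1, -w.2.2.2.1, -w.2.2.2.2) =
      domainIntegral (fun T x => frob (shiftedTensor π.εlam
        (materialTensor π.μ π.C (evM (s.F T) x) (ev (s.p T) x)) (evM (w.F T) x))
        (evM (w.F T) x)) +
      domainIntegral (fun T x => π.εp * ev (w.p T) x * ev (w.p T) x) +
      boundaryIntegral (fun T F x => π.τ T F *
        inner ℝ (tang (outerNormal T F) (evV (w.u T) x - w.uHyb F x))
          (tang (outerNormal T F) (evV (w.u T) x - w.uHyb F x))) := by
  set δ : Fields M k ΓDn ΓDt := (w.1, w.2.1, w.2.2.1, -w.2.2.2.1, -w.2.2.2.2)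
  have hu : δ.u = w.u := rfl
  have hh : δ.uHyb = w.uHyb := rfl
  have hF : δ.F = w.F := rfl
  have hP : δ.P = -w.P := rfl
  have hp : δ.p = -w.p := rfl
  have hcA := fun T => continuousOn_frob_shiftedTensor hd hC hJ T (w.F T) (w.F T)
  have hcb := fun T => continuousOn_bForm hC hJ T (w.p T) (w.F T)
  have hcAb : ∀ T : M.Elem, ContinuousOn (fun x => frob (shiftedTensor π.εlam
      (materialTensor π.μ π.C (evM (s.F T) x) (ev (s.p T) x)) (evM (w.F T) x)) (evM (w.F T) x) +
      bForm π.C (evM (s.F T) x) (ev (w.p T) x) (evM (w.F T) x)) T.carrier :=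
    fun T => (hcA T).add (hcb T)
  have hcb' : ∀ T : M.Elem, ContinuousOn (fun x =>
      -bForm π.C (evM (s.F T) x) (ev (w.p T) x) (evM (w.F T) x)) T.carrier :=
    fun T => (hcb T).neg
  have hcP : ∀ T : M.Elem, ContinuousOn (fun x => -frob (evM (w.P T) x) (evM (w.F T) x))
    T.carrier := fun T => (continuous_frob_evM _ _).neg.continuousOn
  have hcp : ∀ T : M.Elem, ContinuousOn (fun x => π.εp * ev (w.p T) x * ev (w.p T) x) T.carrier :=
    fun T => ((continuous_const.mul (continuous_ev _)).mul (continuous_ev _)).continuousOn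
  have e1 : equationF π s w δ = domainIntegral (fun T x => frob (shiftedTensor π.εlam
        (materialTensor π.μ π.C (evM (s.F T) x) (ev (s.p T) x)) (evM (w.F T) x))
        (evM (w.F T) x)) +
      domainIntegral (fun T x => bForm π.C (evM (s.F T) x) (ev (w.p T) x) (evM (w.F T) x)) -
      domainIntegral (fun T x => frob (evM (w.P T) x) (evM (w.F T) x)) := by
    simp only [equationF, hF, sub_eq_add_neg]
    rw [domainIntegral_add hcAb hcP, domainIntegral_add hcA hcb,
      domainIntegral_neg]
  have e2 : equationp π s w δ =
      -domainIntegral (fun T x => bForm π.C (evM (s.F T) x) (ev (w.p T) x) (evM (w.F T) x)) +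
      domainIntegral (fun T x => π.εp * ev (w.p T) x * ev (w.p T) x) := by
    rw [← domainIntegral_neg, ← domainIntegral_add hcb' hcp]
    simp only [equationp, hp, Pi.neg_apply, ev_neg]
    congr 1
    funext T x
    simp only [bForm]
    ring
  have e3 : equationP w δ = domainIntegral (fun T x => frob (evM (w.P T) x) (evM (w.F T) x)) -
      gradPairing w.u w.P - hybPairing w.uHyb w.P := by
    simp only [equationP, hP, gradPairing_neg_right, hybPairing_neg_right, Pi.neg_apply, evM_neg,
      frob_neg_right, domainIntegral_neg]
    simp only [frob_comm (evM (w.F _) _)]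
    ring
  -- The `b` terms of the `F` and `p` equations cancel, as do the `P : F` terms and the pairings of
  -- `ΔP` with `Δu` and `Δũ`.
  rw [stiffnessForm, e1, e2, e3, equationU, hu, hh]
  ring

/-- Three nonnegative terms add up to zero. The stabilization is used only through its sign, because
`τ` may vanish. -/
lemma F_eq_zero_and_p_eq_zero (hd : d = 2 ∨ d = 3) (hC : IsVolumetricResponse π.C)
    (hεp : 0 < π.εp) (hτ : ∀ T F, 0 ≤ π.τ T F) (hεlam : 0 < π.εlam)
    (hJ : ∀ T : M.Elem, ∀ x ∈ T.carrier, 0 < (evM (s.F T) x).det)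
    (hw : ∀ δ, stiffnessForm π s w δ = 0) : w.F = 0 ∧ w.p = 0 := by
  have hE := stiffnessForm_energy hd hC hJ w
  rw [hw] at hE
  have hA : ∀ (T : M.Elem), ∀ x ∈ T.carrier, 0 ≤ frob (shiftedTensor π.εlam
      (materialTensor π.μ π.C (evM (s.F T) x) (ev (s.p T) x)) (evM (w.F T) x))
      (evM (w.F T) x) := fun T x _ =>
    (mul_nonneg hεlam.le (frob_self_nonneg _)).trans
      (le_frob_shiftedTensor_materialTensor hd _ _ _ _ _ _)
  have hp : ∀ (T : M.Elem), ∀ x ∈ T.carrier, 0 ≤ π.εp * ev (w.p T) x * ev (w.p T) x :=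
    fun T x _ => by rw [mul_assoc]; exact mul_nonneg hεp.le (mul_self_nonneg _)
  have hS : 0 ≤ boundaryIntegral (fun T F x => π.τ T F *
        inner ℝ (tang (outerNormal T F) (evV (w.u T) x - w.uHyb F x))
          (tang (outerNormal T F) (evV (w.u T) x - w.uHyb F x))) :=
    boundaryIntegral_nonneg fun T F x => mul_nonneg (hτ T F) real_inner_self_nonneg
  have hA0 := domainIntegral_nonneg hA
  have hp0 := domainIntegral_nonneg hp
  constructor
  · funext T
    refine eq_zero_of_evM_eq_zero (T := T) fun x hx => eq_zero_of_frob_self ?_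
    have h := eq_zero_of_domainIntegral_eq_zero
      (fun T => continuousOn_frob_shiftedTensor hd hC hJ T (w.F T) (w.F T)) hA (by linarith) T x hx
    have h1 := le_frob_shiftedTensor_materialTensor hd π.εlam π.μ π.C (evM (s.F T) x)
      (ev (s.p T) x) (evM (w.F T) x)
    rw [h] at h1
    exact le_antisymm (nonpos_of_mul_nonpos_right h1 hεlam) (frob_self_nonneg _)
  · funext T
    refine eq_zero_of_ev_eq_zero T.interior_carrier_nonempty fun x hx => ?_
    have h := eq_zero_of_domainIntegral_eq_zero
      (f := fun T x => π.εp * ev (w.p T) x * ev (w.p T) x) (fun T => ((continuous_const.mul (continuous_ev _)).mul (continuous_ev _)).continuousOn) hp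
      (by linarith) T x hx
    rw [mul_assoc] at h
    exact mul_self_eq_zero.1 ((mul_eq_zero.1 h).resolve_left hεp.ne')

lemma shiftedTensor_zero (hd : d = 2 ∨ d = 3) (ε μ : ℝ) (C : ℝ → ℝ) (F : Mat d) (p : ℝ) :
    shiftedTensor ε (materialTensor μ C F p) 0 = 0 := by
  simpa using shiftedTensor_smul hd ε μ C F p 0 0

lemma bForm_zero_left (C : ℝ → ℝ) (F G : Mat d) : bForm C F 0 G = 0 := by simp [bForm]

lemma bForm_zero_right (C : ℝ → ℝ) (F : Mat d) (p : ℝ) : bForm C F p 0 = 0 := by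
  simp [bForm, frob_zero_right]

lemma P_eq_zero (hd : d = 2 ∨ d = 3) (hF : w.F = 0) (hp : w.p = 0)
    (hw : ∀ δ, stiffnessForm π s w δ = 0) : w.P = 0 := by
  -- With `ΔF = 0` and `Δp = 0`, the choice `δF = ΔP` leaves only `-∫ ΔP : ΔP`.
  set δ : Fields M k ΓDn ΓDt :=
    (0, 0, ⟨w.P, defGradSpace_eq_stressSpace.ge w.2.2.2.1.2⟩, 0, 0)
  have hδu : δ.u = 0 := rfl
  have hδh : δ.uHyb = 0 := rfl
  have hδF : δ.F = w.P := rfl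
  have hδP : δ.P = 0 := rfl
  have hδp : δ.p = 0 := rfl
  have h := hw δ
  simp only [stiffnessForm, equationF, equationp, equationP, equationU, hδu, hδh, hδF, hδP, hδp,
    hF, hp, Pi.zero_apply, evM_zero, ev_zero, evV_zero, shiftedTensor_zero hd, frob_zero_left,
    frob_zero_right, bForm_zero_left, gradPairing_zero_left, gradPairing_zero_right,
    hybPairing_zero_left, hybPairing_zero_right, mul_zero, sub_zero, tang_zero, inner_zero_right,
    domainIntegral_zero, boundaryIntegral_zero, add_zero, zero_sub, neg_zero, domainIntegral_neg,
    neg_eq_zero] at h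
  funext T
  exact eq_zero_of_evM_eq_zero fun x hx => eq_zero_of_frob_self
    (eq_zero_of_domainIntegral_eq_zero (fun T => (continuous_frob_evM _ _).continuousOn)
      (fun T x _ => frob_self_nonneg _) h T x hx)

/-- The extension of `R` by zero is tested alone as `δP`; with `ΔF = 0` only the two pairings
survive. -/
lemma elementResidual_eq_zero (hF : w.F = 0) (hw : ∀ δ, stiffnessForm π s w δ = 0) (T : M.Elem)
    (R : Matrix (Fin d) (Fin d) (Poly d))
    (hR : ∀ i j, R i j ∈ MvPolynomial.restrictTotalDegree (Fin d) ℝ k) :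
    elementResidual T (w.u T) w.uHyb R = 0 := by
  classical
  have hmem : (Pi.single T R : M.Elem → Matrix (Fin d) (Fin d) (Poly d)) ∈ stressSpace M k := by
    intro T' i j
    by_cases h : T' = T
    · subst h; simpa using hR i j
    · rw [Pi.single_eq_of_ne h]; exact Submodule.zero_mem _
  set δ : Fields M k ΓDn ΓDt := (0, 0, 0, ⟨_, hmem⟩, 0)
  have hδu : δ.u = 0 := rfl
  have hδh : δ.uHyb = 0 := rfl
  have hδF : δ.F = 0 := rfl
  have hδP : δ.P = Pi.single T R := rfl
  have hδp : δ.p = 0 := rfl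
  have h := hw δ
  simp only [stiffnessForm, equationF, equationp, equationP, equationU, hδu, hδh, hδF, hδP, hδp,
    hF, Pi.zero_apply, evM_zero, ev_zero, evV_zero, frob_zero_left, frob_zero_right,
    bForm_zero_right, gradPairing_zero_left, hybPairing_zero_left, mul_zero,
    sub_zero, tang_zero, inner_zero_right, domainIntegral_zero, boundaryIntegral_zero, add_zero,
    zero_add, neg_zero] at h
  rw [← pairing_single]
  exact h

/-- The tangential part on a facet does not depend on the element that provides the normal. -/
lemma tang_outerNormal_eq (hd : 0 < d) {F : M.Facet} {T T' : M.Elem} (h : F.IsFacetOf T)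
    (h' : F.IsFacetOf T') (x : E d) :
    tang (outerNormal T' F) x = tang (outerNormal T F) x := by
  have hN := norm_outerNormal hd h
  have hN' := norm_outerNormal hd h'
  obtain ⟨c, hc⟩ := exists_smul_eq_of_mem_orthogonal hd F (by rw [← norm_ne_zero_iff, hN]; simp)
    (outerNormal_mem T F) (outerNormal_mem T' F)
  rw [hc] at hN' ⊢
  exact tang_smul_left hN hN' x

lemma Mesh.Facet.exists_isFacetOf (F : M.Facet) : ∃ T : M.Elem, F.IsFacetOf T := by
  obtain ⟨T, hT, hcard, hsub⟩ := M.pure F.1 F.2.1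
  exact ⟨⟨T, hT, hcard⟩, hsub⟩

lemma Mesh.Facet.carrier_nonempty (hd : 0 < d) (F : M.Facet) : F.carrier.Nonempty :=
  convexHull_nonempty_iff.2 (Finset.coe_nonempty.2 (Finset.card_pos.1 (by rw [F.2.2]; exact hd)))

/-- Data that agree on any two elements with a common facet are constant. -/
lemma Mesh.eq_of_connected (hd : 0 < d) {α : Type*} (c : M.Elem → α)
    (h : ∀ (F : M.Facet) (T T' : M.Elem), F.IsFacetOf T → F.IsFacetOf T' → c T = c T')
    (T T' : M.Elem) : c T = c T' := by
  have hconn := M.connected T.1 T.2.1 T'.1 T'.2.1 T.2.2 T'.2.2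
  -- The chain consists of bare vertex sets, so the induction also carries the proof that each of
  -- them is an element.
  have hall : ∀ B : Finset (E d), Relation.ReflTransGen
      (fun A B : Finset (E d) => B ∈ M.complex.faces ∧ B.card = d + 1 ∧
        ∃ F : Finset (E d), F.card = d ∧ F ⊆ A ∧ F ⊆ B) T.1 B →
      ∃ hB : B ∈ M.complex.faces ∧ B.card = d + 1, c T = c ⟨B, hB⟩ := by
    intro B hB
    induction hB with
    | refl => exact ⟨T.2, rfl⟩
    | tail _ hstep ih =>
      obtain ⟨hA, hcA⟩ := ih
      obtain ⟨hBf, hBc, F, hFc, hFA, hFB⟩ := hstep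
      have hF : F ∈ M.complex.faces :=
        M.complex.down_closed hBf hFB (Finset.card_pos.1 (by rw [hFc]; exact hd))
      exact ⟨⟨hBf, hBc⟩, hcA.trans (h ⟨F, hF, hFc⟩ ⟨_, hA⟩ ⟨_, hBf, hBc⟩ hFA hFB)⟩
  obtain ⟨_, hc⟩ := hall T'.1 hconn
  exact hc

/-- The stiffness form is nondegenerate. -/
lemma eq_zero_of_stiffnessForm_eq_zero (hd : d = 2 ∨ d = 3)
    (hΓ : ∀ c : E d,
      (∀ F ∈ ΓDn, ∀ T : M.Elem, F.IsFacetOf T → inner ℝ c (outerNormal T F) = 0) →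
      (∀ F ∈ ΓDt, ∀ T : M.Elem, F.IsFacetOf T → tang (outerNormal T F) c = 0) → c = 0)
    (hC : IsVolumetricResponse π.C) (hεp : 0 < π.εp) (hτ : ∀ T F, 0 ≤ π.τ T F)
    (hεlam : 0 < π.εlam)
    (hJ : ∀ T : M.Elem, ∀ x ∈ T.carrier, 0 < (evM (s.F T) x).det)
    (hw : ∀ δ, stiffnessForm π s w δ = 0) : w = 0 := by
  have hd' : 0 < d := by omega
  obtain ⟨hF, hp⟩ := F_eq_zero_and_p_eq_zero hd hC hεp hτ hεlam hJ hw
  have hP := P_eq_zero hd hF hp hw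
  have hloc : ∀ T : M.Elem, ∃ c : E d, (w.u T = fun i => MvPolynomial.C (c i)) ∧
      ∀ F : M.Facet, F.IsFacetOf T → ∀ x ∈ F.carrier,
        tang (outerNormal T F) (c - w.uHyb F x) = 0 := fun T =>
    exists_const_of_elementResidual hd' (w.1.2.1 T)
      (fun F => let ⟨q, hq₁, hq₂, _⟩ := w.2.1.2.1 F; ⟨q, hq₁, hq₂⟩)
      (elementResidual_eq_zero hF hw T)
  choose c hcu hct using hloc
  have hev : ∀ T x, evV (w.u T) x = c T := fun T x => by
    ext i
    rw [hcu T]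
    simp [evV, ev]
  -- Across a common facet the tangential parts agree because both equal the single-valued `ũ_t`,
  -- and the normal parts by Raviart–Thomas continuity. One point of the facet suffices, the values
  -- being constant.
  have hconst : ∀ T T', c T = c T' := M.eq_of_connected hd' c fun F T T' h h' => by
    obtain ⟨x, hx⟩ := F.carrier_nonempty hd'
    rw [← sub_eq_zero]
    refine eq_zero_of_tang_eq_zero (N := outerNormal T F) ?_ ?_
    · have h1 := hct T F h x hx
      have h2 := hct T' F h' x hx
      rw [tang_outerNormal_eq hd' h h'] at h2
      rw [tang_sub] at h1 h2 ⊢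
      rw [sub_eq_zero] at h1 h2 ⊢
      rw [h1, h2]
    · have h1 := w.1.2.2.1 F T T' h h' x hx
      change inner ℝ (evV (w.u T) x - evV (w.u T') x) _ = 0 at h1
      rwa [hev, hev] at h1
  -- The global constant inherits `c · N = 0` on `ΓDn` from `u` and `c_t = 0` on `ΓDt` from `ũ = 0`.
  have hc0 : ∀ T, c T = 0 := fun T => by
    refine hΓ (c T) (fun F hFn T' h => ?_) fun F hFt T' h => ?_
    · obtain ⟨x, hx⟩ := F.carrier_nonempty hd'
      have h1 := w.1.2.2.2 F hFn T' h x hx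
      change inner ℝ (evV (w.u T') x) _ = 0 at h1
      rwa [hev, hconst T' T] at h1
    · obtain ⟨x, hx⟩ := F.carrier_nonempty hd'
      have h1 := hct T' F h x hx
      have h2 : w.uHyb F x = 0 := w.2.1.2.2.2 F hFt x hx
      rwa [h2, sub_zero, hconst T' T] at h1
  have hu : w.u = 0 := by
    funext T i
    rw [hcu T, hc0 T]
    simp
  have hh : w.uHyb = 0 := by
    funext F x
    -- On the facet both the tangential and the normal part of `ũ` vanish; elsewhere it is zero by
    -- the convention for facet fields.
    by_cases hx : x ∈ F.carrier
    · obtain ⟨T, hT⟩ := F.exists_isFacetOf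
      refine eq_zero_of_tang_eq_zero (N := outerNormal T F) ?_ (w.2.1.2.2.1 F T hT x hx)
      have h1 := hct T F hT x hx
      rw [hc0, tang_sub, tang_zero, zero_sub, neg_eq_zero] at h1
      exact h1
    · obtain ⟨q, -, -, hq⟩ := w.2.1.2.1 F
      exact hq x hx
  exact Prod.ext (Subtype.ext hu) (Prod.ext (Subtype.ext hh) (Prod.ext (Subtype.ext hF)
    (Prod.ext (Subtype.ext hP) (Subtype.ext hp))))

end Kernel

end Nondegeneracy

end NDTNS

end

/-! ### From the trivial kernel to invertibility of the matrix. -/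

theorem mainTheorem2 {d : ℕ} (hd : d = 2 ∨ d = 3) (M : NDTNS.Mesh d) (k : ℕ)
    (ΓDn ΓDt : Set M.Facet)
    (hΓDn : ∀ F ∈ ΓDn, F.IsBoundary) (hΓDt : ∀ F ∈ ΓDt, F.IsBoundary)
    (hΓ : ∀ c : NDTNS.E d,
      (∀ F ∈ ΓDn, ∀ T : M.Elem, F.IsFacetOf T → inner ℝ c (NDTNS.outerNormal T F) = 0) →
      (∀ F ∈ ΓDt, ∀ T : M.Elem, F.IsFacetOf T → NDTNS.tang (NDTNS.outerNormal T F) c = 0) →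
      c = 0)
    (π : NDTNS.Params M) (hμ : 0 < π.μ) (hC : NDTNS.IsVolumetricResponse π.C)
    (hεp : 0 < π.εp) (hτ : ∀ T F, 0 ≤ π.τ T F)
    (hεlam : 0 < π.εlam)
    (s : NDTNS.Fields M k ∅ ∅)
    (hJ : ∀ T : M.Elem, ∀ x ∈ T.carrier, 0 < (NDTNS.evM (s.F T) x).det) :
    FiniteDimensional ℝ (NDTNS.Fields M k ΓDn ΓDt) ∧
      ∀ (ι : Type) [Fintype ι] [DecidableEq ι]
        (b : Module.Basis ι ℝ (NDTNS.Fields M k ΓDn ΓDt)),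
        IsUnit (NDTNS.stiffnessMatrix π s b) := by
  refine ⟨inferInstance, fun ι _ _ b => ?_⟩
  rw [← Matrix.mulVec_injective_iff_isUnit,
    ← Matrix.coe_mulVecLin, ← LinearMap.ker_eq_bot, LinearMap.ker_eq_bot']
  intro a ha
  -- Columns index increments and rows index test functions, so a kernel vector of the matrix is the
  -- coefficient vector of an increment annihilated by all basis test functions.
  have hb : ∀ i, NDTNS.stiffnessForm π s (∑ j, a j • b j) (b i) = 0 := fun i => by
    have hL := map_sum ((NDTNS.stiffnessForm_isLinearMap_left (π := π) (s := s) (b i) hd hC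
      hJ).mk' _) (fun j => a j • b j) Finset.univ
    simp only [map_smul, IsLinearMap.mk'_apply, smul_eq_mul] at hL
    have hi := congrFun ha i
    simp only [Matrix.mulVecLin_apply, Matrix.mulVec, dotProduct, NDTNS.stiffnessMatrix,
      Matrix.of_apply, Pi.zero_apply] at hi
    rw [hL, ← hi]
    exact Finset.sum_congr rfl fun j _ => mul_comm _ _
  -- Linearity in the test function extends this from the basis to the whole space.
  have hw : ∀ δ, NDTNS.stiffnessForm π s (∑ j, a j • b j) δ = 0 := fun δ => by
    have hR : (NDTNS.stiffnessForm_isLinearMap_right (π := π) (s := s)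
        (∑ j, a j • b j) hd hC hJ).mk' _ = 0 := b.ext hb
    exact LinearMap.congr_fun hR δ
  have h0 := NDTNS.eq_zero_of_stiffnessForm_eq_zero hd hΓ hC hεp hτ hεlam hJ hw
  have := Fintype.linearIndependent_iff.1 b.linearIndependent a h0
  exact funext this
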